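/- Let $k,l\ge 2$. Let $G_k\subseteq \mathrm{SU}(k)$ and $G_l\subseteq\mathrm{SU}(l)$ be subgroups that act irreducibly, by the adjoint action $\mathrm{Ad}_g(X)=gXg^\dagger$, on $\mathfrak{sl}(k,\mathbb C)$ and $\mathfrak{sl}(l,\mathbb C)$ respectively (where $\mathfrak{sl}(n,\mathbb C)$ is the space of trace-zero complex $n\times n$ matrices), and let $V\in\mathrm{SU}(kl)$, acting on $\mathbb C^{kl}=\mathbb C^k\otimes\mathbb C^l$. Write $H=\mathrm{SU}(k)\otimes\mathrm{SU}(l)=\{A\otimes B: A\in \mathrm{SU}(k),\,B\in\mathrm{SU}(l)\}\subseteq\mathrm{SU}(kl)$. Then the group $\langle G_k\otimes I,\ I\otimes G_l,\ V\rangle$ acts irreducibly on $\mathfrak{sl}(kl,\mathbb C)$ by the adjoint action if and only if $V\notin N_{\mathrm{SU}(kl)}(H)$, the normalizer of $H$ in $\mathrm{SU}(kl)$. Moreover, this normalizer is, up to global phases: 1. if $k\neq l$, the group $H$ itself: $N_{\mathrm{SU}(kl)}(H)=\{U\in\mathrm{SU}(kl): U=cW \text{ for some } c\in\mathbb C,\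 |c|=1,\ W\in H\}$; 2. if $k=l$, the group generated by $H$ and SWAP: $N_{\mathrm{SU}(k^2)}(H)=\{U\in\mathrm{SU}(k^2): U=cW \text{ for some } c\in\mathbb C,\ |c|=1,\ W\in\langle H,S\rangle\subseteq\mathrm U(k^2)\}$, where $S(u\otimes v)=v\otimes u$. -/

import Mathlib

open scoped Kronecker Matrix

noncomputable section

/-- `SU(n)`, with coordinates indexed by a finite type `n`. -/
abbrev SU (n : Type) [Fintype n] [DecidableEq n] : Type :=
  Matrix.specialUnitaryGroup n ℂ

/-- `𝔰𝔩(n, ℂ)`, the trace-zero complex matrices. -/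
abbrev slC (n : Type) [Fintype n] [DecidableEq n] : Type :=
  LieAlgebra.SpecialLinear.sl n ℂ

theorem mem_slC_iff {n : Type} [Fintype n] [DecidableEq n] (X : Matrix n n ℂ) :
    X ∈ LieAlgebra.SpecialLinear.sl n ℂ ↔ X.trace = 0 :=
  Iff.rfl

theorem SU.star_mul_self {n : Type} [Fintype n] [DecidableEq n] (g : SU n) :
    (g : Matrix n n ℂ)ᴴ * (g : Matrix n n ℂ) = 1 :=
  Matrix.mem_unitaryGroup_iff'.1 (Matrix.mem_specialUnitaryGroup_iff.1 g.2).1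

theorem SU.trace_conj {n : Type} [Fintype n] [DecidableEq n] (g : SU n) (X : Matrix n n ℂ) :
    ((g : Matrix n n ℂ) * X * (g : Matrix n n ℂ)ᴴ).trace = X.trace := by
  rw [Matrix.trace_mul_comm, ← Matrix.mul_assoc, SU.star_mul_self, Matrix.one_mul]

/-- The (complexified) adjoint representation of `SU(n)` on `𝔰𝔩(n, ℂ)`, `Ad_g X = g X g†`. -/
def adRep (n : Type) [Fintype n] [DecidableEq n] : Representation ℂ (SU n) (slC n) where
  toFun g :=
    { toFun := fun X => ⟨(g : Matrix n n ℂ) * (X : Matrix n n ℂ) * (g : Matrix n n ℂ)ᴴ,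
        (mem_slC_iff _).2 ((SU.trace_conj g _).trans ((mem_slC_iff _).1 X.2))⟩
      map_add' := fun X Y => Subtype.ext (by simp [Matrix.mul_add, Matrix.add_mul])
      map_smul' := fun c X => Subtype.ext (by simp) }
  map_one' := by
    ext X : 1
    exact Subtype.ext (by simp)
  map_mul' g h := by
    ext X : 1
    exact Subtype.ext (by simp [Matrix.conjTranspose_mul, Matrix.mul_assoc])

/-- `G ≤ SU(n)` acts irreducibly on `𝔰𝔩(n, ℂ)` through the adjoint representation. -/
def AdjointIrreducible {n : Type} [Fintype n] [DecidableEq n] (G : Subgroup (SU n)) : Prop :=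
  Representation.IsIrreducible ((adRep n).comp G.subtype)

/-- The homomorphism `SU(m) × SU(n) → SU(mn)`, `(A, B) ↦ A ⊗ B`; the coordinates of
`ℂ^m ⊗ ℂ^n` are indexed by `m × n`. -/
def tensorHom (m n : Type) [Fintype m] [DecidableEq m] [Fintype n] [DecidableEq n] :
    SU m × SU n →* SU (m × n) where
  toFun p := ⟨(p.1 : Matrix m m ℂ) ⊗ₖ (p.2 : Matrix n n ℂ), by
    have hA := Matrix.mem_specialUnitaryGroup_iff.1 p.1.2
    have hB := Matrix.mem_specialUnitaryGroup_iff.1 p.2.2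
    refine Matrix.mem_specialUnitaryGroup_iff.2 ⟨Matrix.kronecker_mem_unitary hA.1 hB.1, ?_⟩
    rw [Matrix.det_kronecker, hA.2, hB.2, one_pow, one_pow, one_mul]⟩
  map_one' := Subtype.ext (by simp)
  map_mul' p q := Subtype.ext (by simp [Matrix.mul_kronecker_mul])

/-- The subgroup `SU(m) ⊗ SU(n)` of `SU(mn)`. -/
def productSU (m n : Type) [Fintype m] [DecidableEq m] [Fintype n] [DecidableEq n] :
    Subgroup (SU (m × n)) :=
  (tensorHom m n).range

/-- The subgroup `⟨A ⊗ I, I ⊗ B, V⟩` of `SU(mn)`. -/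
def mixedGroup {m n : Type} [Fintype m] [DecidableEq m] [Fintype n] [DecidableEq n]
    (A : Subgroup (SU m)) (B : Subgroup (SU n)) (V : SU (m × n)) : Subgroup (SU (m × n)) :=
  Subgroup.closure
    ({U | ∃ a ∈ A, U = tensorHom m n (a, 1)} ∪ {U | ∃ b ∈ B, U = tensorHom m n (1, b)} ∪ {V})

/-- The inclusion of `SU(n)` in `U(n)`. -/
def SU.toU (n : Type) [Fintype n] [DecidableEq n] : SU n →* Matrix.unitaryGroup n ℂ :=
  Submonoid.inclusion Matrix.specialUnitaryGroup_le_unitaryGroup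

/-- The exchange of the two coordinates on `Fin k × Fin l` when `k = l`. -/
def swapPerm {k l : ℕ} (h : k = l) : Equiv.Perm (Fin k × Fin l) where
  toFun p := (Fin.cast h.symm p.2, Fin.cast h p.1)
  invFun p := (Fin.cast h.symm p.2, Fin.cast h p.1)
  left_inv _ := rfl
  right_inv _ := rfl

/-- The operator SWAP on `ℂ^k ⊗ ℂ^l`, `k = l`. Its determinant may be `-1`, so it is taken
in the full unitary group. -/
def swapU {k l : ℕ} (h : k = l) : Matrix.unitaryGroup (Fin k × Fin l) ℂ :=
  ⟨(swapPerm h).permMatrix ℂ, by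
    rw [Matrix.mem_unitaryGroup_iff, Matrix.star_eq_conjTranspose, Matrix.conjTranspose_permMatrix,
      ← Matrix.permMatrix_mul]
    simp⟩

/-- `SWAP (u ⊗ v) = v ⊗ u`. -/
theorem swapU_mulVec {k : ℕ} (u v : Fin k → ℂ) :
    (swapU (rfl : k = k) : Matrix (Fin k × Fin k) (Fin k × Fin k) ℂ) *ᵥ (fun p => u p.1 * v p.2)
      = fun p => v p.1 * u p.2 := by
  ext p
  simp [swapU, swapPerm, Matrix.permMatrix_mulVec, mul_comm]

/-- The elements of `SU(n)` that belong to `K ≤ U(n)` up to a global phase. -/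
def upToPhase {n : Type} [Fintype n] [DecidableEq n]
    (K : Subgroup (Matrix.unitaryGroup n ℂ)) : Set (SU n) :=
  {U | ∃ c : ℂ, ‖c‖ = 1 ∧ ∃ W ∈ K, (U : Matrix n n ℂ) = c • (W : Matrix n n ℂ)}

end

/-!
Write `L = M_m ⊗ 1`, `R = 1 ⊗ M_n` and `E = L + R`; the traceless part of `E` is the complexified Lie
algebra of `SU(m) ⊗ SU(n)`. Everything is reduced to one question: which unitaries `V` on
`ℂ^m ⊗ ℂ^n` map `L` and `R` into `E` under conjugation?

*Unitaries preserving `E`.* If an element `X ⊗ 1 + 1 ⊗ Y` and its square both lie in `E`, then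
`X ⊗ Y ∈ E`, which forces `X` or `Y` to be scalar. Hence conjugation maps each element of `L` into
`L ∪ R`, and, since a vector space is not the union of two proper subspaces, it maps `L` into `L` or
into `R` (`conj_leftLocal_dichotomy`). If it maps `L` into `L`, then `V` is a product of unitaries
(`exists_kronecker_of_conj_leftLocal`). If it maps `L` into `R`, then either `m = n` and SWAP reduces
to the previous case, or a dimension count shows that `R` goes into `R`.

*Normalizing elements preserve `E`.* For a projection `P` and a phase `z`, the unitary
`1 + (z - 1) P ⊗ 1` is a product up to a phase, so its conjugate by a normalizing element `V` is a
product operator. The `2 × 2` minors expressing this are polynomials in `z - 1`, and their linear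
coefficients say that `V (P ⊗ 1) V†` lies in `E` (`mem_localSum_of_one_add_smul`). Projections span
all matrices. This gives the description of the normalizer, and shows that `V` in the normalizer
makes the traceless part of `E` a proper invariant subspace.

*Reducible groups.* By Burnside's theorem (`asAlgebraHom_surjective_of_isIrreducible`) the operators
of `G_k` span all linear maps of `𝔰𝔩(k)`, even independently of their action on the scalars
(`exists_asAlgebraHom_eq`), and likewise for `G_l`. An invariant subspace `W` of the group generated
by `G_k ⊗ 1`, `1 ⊗ G_l` and `V` is therefore stable under many operators `T ⊗ id` and `id ⊗ T`; so it
contains `𝔰𝔩(k) ⊗ 𝔰𝔩(l)` or lies in `E` (`IsLiftStable.le_localSum_or_kronecker_mem`). Since `W` and its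
orthogonal complement for the trace form cannot both contain `𝔰𝔩(k) ⊗ 𝔰𝔩(l)`, one of them lies in
`E`, hence is `𝔰𝔩(k) ⊗ 1`, `1 ⊗ 𝔰𝔩(l)` or their sum. As `V` preserves it, `V` is of the form found in
the first step and belongs to the normalizer.
-/

set_option linter.unusedSectionVars false

/-! ### Unitaries preserving the local operators -/

section LocalAlgebras

variable {m n : Type} [Fintype m] [DecidableEq m] [Fintype n] [DecidableEq n]

/-- `X ↦ X ⊗ 1`, as a linear map. -/
def leftEmb (m n : Type) [DecidableEq n] :
    Matrix m m ℂ →ₗ[ℂ] Matrix (m × n) (m × n) ℂ where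
  toFun X := X ⊗ₖ (1 : Matrix n n ℂ)
  map_add' X Y := Matrix.add_kronecker X Y 1
  map_smul' c X := Matrix.smul_kronecker c X 1

/-- `Y ↦ 1 ⊗ Y`, as a linear map. -/
def rightEmb (m n : Type) [DecidableEq m] :
    Matrix n n ℂ →ₗ[ℂ] Matrix (m × n) (m × n) ℂ where
  toFun Y := (1 : Matrix m m ℂ) ⊗ₖ Y
  map_add' X Y := Matrix.kronecker_add 1 X Y
  map_smul' c X := Matrix.kronecker_smul c 1 X

/-- The operators `X ⊗ 1` on `ℂ^m ⊗ ℂ^n`. -/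
def leftLocal (m n : Type) [DecidableEq n] : Submodule ℂ (Matrix (m × n) (m × n) ℂ) :=
  LinearMap.range (leftEmb m n)

/-- The operators `1 ⊗ Y` on `ℂ^m ⊗ ℂ^n`. -/
def rightLocal (m n : Type) [DecidableEq m] : Submodule ℂ (Matrix (m × n) (m × n) ℂ) :=
  LinearMap.range (rightEmb m n)

/-- The operators `X ⊗ 1 + 1 ⊗ Y`, the complexified Lie algebra of `U(m) ⊗ U(n)`. -/
def localSum (m n : Type) [DecidableEq m] [DecidableEq n] :
    Submodule ℂ (Matrix (m × n) (m × n) ℂ) :=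
  leftLocal m n ⊔ rightLocal m n

theorem mem_leftLocal {M : Matrix (m × n) (m × n) ℂ} :
    M ∈ leftLocal m n ↔ ∃ X : Matrix m m ℂ, X ⊗ₖ (1 : Matrix n n ℂ) = M := Iff.rfl

theorem mem_rightLocal {M : Matrix (m × n) (m × n) ℂ} :
    M ∈ rightLocal m n ↔ ∃ Y : Matrix n n ℂ, (1 : Matrix m m ℂ) ⊗ₖ Y = M := Iff.rfl

theorem mem_localSum {M : Matrix (m × n) (m × n) ℂ} :
    M ∈ localSum m n ↔ ∃ (X : Matrix m m ℂ) (Y : Matrix n n ℂ),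
      X ⊗ₖ (1 : Matrix n n ℂ) + (1 : Matrix m m ℂ) ⊗ₖ Y = M := by
  simp only [localSum, Submodule.mem_sup, mem_leftLocal, mem_rightLocal]
  constructor
  · rintro ⟨_, ⟨X, rfl⟩, _, ⟨Y, rfl⟩, rfl⟩
    exact ⟨X, Y, rfl⟩
  · rintro ⟨X, Y, rfl⟩
    exact ⟨_, ⟨X, rfl⟩, _, ⟨Y, rfl⟩, rfl⟩

theorem kronecker_one_injective [Nonempty n] {X Y : Matrix m m ℂ}
    (h : X ⊗ₖ (1 : Matrix n n ℂ) = Y ⊗ₖ (1 : Matrix n n ℂ)) : X = Y := by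
  obtain ⟨a⟩ := ‹Nonempty n›
  ext i j
  simpa using congrFun (congrFun h (i, a)) (j, a)

theorem one_kronecker_injective [Nonempty m] {X Y : Matrix n n ℂ}
    (h : (1 : Matrix m m ℂ) ⊗ₖ X = (1 : Matrix m m ℂ) ⊗ₖ Y) : X = Y := by
  obtain ⟨a⟩ := ‹Nonempty m›
  ext i j
  simpa using congrFun (congrFun h (a, i)) (a, j)

/-- The block of an operator on `ℂ^m ⊗ ℂ^n` at the positions `a`, `b` of the second factor. -/
def block (M : Matrix (m × n) (m × n) ℂ) (a b : n) : Matrix m m ℂ :=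
  M.submatrix (fun i => (i, a)) (fun j => (j, b))

theorem block_mul_kronecker_one (M : Matrix (m × n) (m × n) ℂ) (X : Matrix m m ℂ) (a b : n) :
    block (M * (X ⊗ₖ (1 : Matrix n n ℂ))) a b = block M a b * X := by
  ext i j
  simp [block, Matrix.mul_apply, Fintype.sum_prod_type, Matrix.one_apply]

theorem block_kronecker_one_mul (M : Matrix (m × n) (m × n) ℂ) (X : Matrix m m ℂ) (a b : n) :
    block ((X ⊗ₖ (1 : Matrix n n ℂ)) * M) a b = X * block M a b := by
  ext i j
  simp [block, Matrix.mul_apply, Fintype.sum_prod_type, Matrix.one_apply]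

theorem exists_eq_smul_one_of_forall_mul_comm {F : Matrix m m ℂ}
    (h : ∀ X : Matrix m m ℂ, F * X = X * F) : ∃ c : ℂ, F = c • (1 : Matrix m m ℂ) := by
  obtain ⟨c, hc⟩ := Matrix.mem_range_scalar_iff_commute_single'.2
    (fun i j => (h (Matrix.single i j 1)).symm)
  exact ⟨c, by rw [← hc, Matrix.scalar_apply, Matrix.smul_one_eq_diagonal]⟩

/-- The commutant of `M_m ⊗ 1` is `1 ⊗ M_n`. -/
theorem mem_rightLocal_of_forall_mul_comm {M : Matrix (m × n) (m × n) ℂ}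
    (h : ∀ X : Matrix m m ℂ, M * (X ⊗ₖ (1 : Matrix n n ℂ)) = (X ⊗ₖ (1 : Matrix n n ℂ)) * M) :
    M ∈ rightLocal m n := by
  have hb : ∀ a b, ∃ c : ℂ, block M a b = c • (1 : Matrix m m ℂ) := fun a b =>
    exists_eq_smul_one_of_forall_mul_comm fun X => by
      rw [← block_mul_kronecker_one, h, block_kronecker_one_mul]
  choose c hc using hb
  refine mem_rightLocal.2 ⟨Matrix.of c, ?_⟩
  ext ⟨i, a⟩ ⟨j, b⟩
  have := congrFun (congrFun (hc a b) i) j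
  simp only [block, Matrix.submatrix_apply] at this
  simp [this, mul_comm]

open scoped ComplexOrder in
/-- A unitary that conjugates `M_m ⊗ 1` into itself is a product of unitaries. A nonzero block `F`
of `V` intertwines `X` with its image `φ X`, so `F† F` is central and `F` is a multiple of a
unitary `A`; then `(A† ⊗ 1) V` commutes with `M_m ⊗ 1`. -/
theorem exists_kronecker_of_conj_leftLocal [Nonempty m] [Nonempty n]
    {V : Matrix (m × n) (m × n) ℂ} (hV : V ∈ Matrix.unitaryGroup (m × n) ℂ)
    (h : ∀ X : Matrix m m ℂ, V * (X ⊗ₖ (1 : Matrix n n ℂ)) * Vᴴ ∈ leftLocal m n) :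
    ∃ A ∈ Matrix.unitaryGroup m ℂ, ∃ B ∈ Matrix.unitaryGroup n ℂ, V = A ⊗ₖ B := by
  have hV1 : V * Vᴴ = 1 := Matrix.mem_unitaryGroup_iff.1 hV
  have hV2 : Vᴴ * V = 1 := Matrix.mem_unitaryGroup_iff'.1 hV
  simp only [mem_leftLocal] at h
  choose φ hφ using h
  have hφV : ∀ X, V * (X ⊗ₖ (1 : Matrix n n ℂ)) = (φ X ⊗ₖ (1 : Matrix n n ℂ)) * V := fun X => by
    rw [hφ, Matrix.mul_assoc, hV2, Matrix.mul_one]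
  have hstar : ∀ X, φ Xᴴ = (φ X)ᴴ := fun X => by
    apply kronecker_one_injective (n := n)
    have := congrArg Matrix.conjTranspose (hφ X)
    rw [Matrix.conjTranspose_kronecker, Matrix.conjTranspose_one] at this
    rw [this, hφ]
    simp [Matrix.conjTranspose_mul, Matrix.conjTranspose_kronecker, Matrix.mul_assoc]
  have hFX : ∀ a b X, block V a b * X = φ X * block V a b := fun a b X => by
    rw [← block_mul_kronecker_one, hφV, block_kronecker_one_mul]
  obtain ⟨a, b, hF⟩ : ∃ a b, block V a b ≠ 0 := by
    by_contra! h0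
    have : V = 0 := by
      ext ⟨i, a⟩ ⟨j, b⟩
      exact congrFun (congrFun (h0 a b) i) j
    rw [this, Matrix.zero_mul] at hV1
    exact zero_ne_one hV1
  set F := block V a b with hFdef
  obtain ⟨c, hc⟩ : ∃ c : ℂ, Fᴴ * F = c • (1 : Matrix m m ℂ) := by
    apply exists_eq_smul_one_of_forall_mul_comm
    intro X
    have h2 : Fᴴ * φ X = X * Fᴴ := by
      have := congrArg Matrix.conjTranspose (hFX a b Xᴴ)
      simpa [Matrix.conjTranspose_mul, hstar] using this.symm
    rw [Matrix.mul_assoc, hFX, ← Matrix.mul_assoc, h2, Matrix.mul_assoc]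
  obtain ⟨i0⟩ := ‹Nonempty m›
  have hc0 : c ≠ 0 := by
    rintro rfl
    rw [zero_smul, Matrix.conjTranspose_mul_self_eq_zero] at hc
    exact hF hc
  obtain ⟨r, hr, hrc⟩ : ∃ r : ℝ, 0 ≤ r ∧ c = r := by
    refine ⟨∑ i, ‖F i i0‖ ^ 2, Finset.sum_nonneg fun _ _ => sq_nonneg _, ?_⟩
    have := congrFun (congrFun hc i0) i0
    simp only [Matrix.mul_apply, Matrix.conjTranspose_apply, Matrix.smul_apply,
      Matrix.one_apply_eq, smul_eq_mul, mul_one] at this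
    rw [← this]
    push_cast
    exact Finset.sum_congr rfl fun i _ => Complex.conj_mul' _
  have hr0 : r ≠ 0 := by rintro rfl; exact hc0 (by simpa using hrc)
  set s : ℂ := (((Real.sqrt r)⁻¹ : ℝ) : ℂ) with hs
  have hss : s * s * c = 1 := by
    rw [hs, hrc, ← Complex.ofReal_mul, ← Complex.ofReal_mul, ← mul_inv, Real.mul_self_sqrt hr,
      inv_mul_cancel₀ hr0, Complex.ofReal_one]
  have hsr : star s = s := Complex.conj_ofReal _
  set A := s • F with hA
  have hAA : Aᴴ * A = 1 := by
    rw [hA, Matrix.conjTranspose_smul, Matrix.smul_mul, Matrix.mul_smul, hc, smul_smul, smul_smul,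
      hsr, hss, one_smul]
  have hAA' : A * Aᴴ = 1 := mul_eq_one_comm.1 hAA
  have hAX : ∀ X, Aᴴ * φ X = X * Aᴴ := fun X => by
    have h1 : A * X = φ X * A := by rw [hA, Matrix.smul_mul, hFX, Matrix.mul_smul]
    calc Aᴴ * φ X = Aᴴ * (φ X * A) * Aᴴ := by
          rw [Matrix.mul_assoc, Matrix.mul_assoc, hAA', Matrix.mul_one]
      _ = X * Aᴴ := by rw [← h1, ← Matrix.mul_assoc, hAA, Matrix.one_mul]
  obtain ⟨B, hB⟩ : (Aᴴ ⊗ₖ (1 : Matrix n n ℂ)) * V ∈ rightLocal m n := by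
    apply mem_rightLocal_of_forall_mul_comm
    intro X
    rw [Matrix.mul_assoc, hφV, ← Matrix.mul_assoc, ← Matrix.mul_assoc, ← Matrix.mul_kronecker_mul,
      ← Matrix.mul_kronecker_mul, hAX]
  change (1 : Matrix m m ℂ) ⊗ₖ B = _ at hB
  have hVAB : V = A ⊗ₖ B := by
    have := congrArg (fun M => (A ⊗ₖ (1 : Matrix n n ℂ)) * M) hB
    simp only [← Matrix.mul_assoc, ← Matrix.mul_kronecker_mul, hAA', Matrix.one_mul,
      Matrix.mul_one, Matrix.one_kronecker_one] at this
    exact this.symm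
  refine ⟨A, Matrix.mem_unitaryGroup_iff.2 hAA', B, Matrix.mem_unitaryGroup_iff'.2 ?_, hVAB⟩
  have : Nonempty m := ⟨i0⟩
  apply one_kronecker_injective (m := m)
  have h1 := hV2
  rw [hVAB, Matrix.conjTranspose_kronecker, ← Matrix.mul_kronecker_mul, hAA] at h1
  rw [Matrix.star_eq_conjTranspose, h1, Matrix.one_kronecker_one]

theorem submatrix_swap_kronecker (X : Matrix m m ℂ) (Y : Matrix n n ℂ) :
    (X ⊗ₖ Y).submatrix Prod.swap Prod.swap = Y ⊗ₖ X := by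
  ext ⟨a, i⟩ ⟨b, j⟩
  simp [mul_comm]

/-- The mirror image of `exists_kronecker_of_conj_leftLocal`. -/
theorem exists_kronecker_of_conj_rightLocal [Nonempty m] [Nonempty n]
    {V : Matrix (m × n) (m × n) ℂ} (hV : V ∈ Matrix.unitaryGroup (m × n) ℂ)
    (h : ∀ Y : Matrix n n ℂ, V * ((1 : Matrix m m ℂ) ⊗ₖ Y) * Vᴴ ∈ rightLocal m n) :
    ∃ A ∈ Matrix.unitaryGroup m ℂ, ∃ B ∈ Matrix.unitaryGroup n ℂ, V = A ⊗ₖ B := by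
  have hmul : ∀ M N : Matrix (m × n) (m × n) ℂ,
      M.submatrix Prod.swap Prod.swap * N.submatrix Prod.swap Prod.swap =
        ((M * N).submatrix Prod.swap Prod.swap : Matrix (n × m) (n × m) ℂ) := fun M N =>
    Matrix.submatrix_mul_equiv M N Prod.swap (Equiv.prodComm n m) Prod.swap
  have hV' : V.submatrix Prod.swap Prod.swap ∈ Matrix.unitaryGroup (n × m) ℂ := by
    rw [Matrix.mem_unitaryGroup_iff, Matrix.star_eq_conjTranspose, Matrix.conjTranspose_submatrix,
      hmul, ← Matrix.star_eq_conjTranspose, Matrix.mem_unitaryGroup_iff.1 hV]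
    exact Matrix.submatrix_one_equiv (Equiv.prodComm n m)
  obtain ⟨B, hB, A, hA, hAB⟩ := exists_kronecker_of_conj_leftLocal hV' fun Y => by
    obtain ⟨Z, hZ⟩ := mem_rightLocal.1 (h Y)
    refine mem_leftLocal.2 ⟨Z, ?_⟩
    rw [← submatrix_swap_kronecker (1 : Matrix m m ℂ) Z, hZ,
      ← submatrix_swap_kronecker (1 : Matrix m m ℂ) Y, hmul, Matrix.conjTranspose_submatrix, hmul]
  refine ⟨A, hA, B, hB, ?_⟩
  rw [← submatrix_swap_kronecker, ← hAB]
  rfl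

/-- `X ⊗ Y` is a sum of local operators only if one of the factors is scalar. -/
theorem exists_smul_one_of_kronecker_mem_localSum {X : Matrix m m ℂ} {Y : Matrix n n ℂ}
    (h : X ⊗ₖ Y ∈ localSum m n) :
    (∃ c : ℂ, X = c • (1 : Matrix m m ℂ)) ∨ ∃ c : ℂ, Y = c • (1 : Matrix n n ℂ) := by
  obtain ⟨P, Q, hPQ⟩ := mem_localSum.1 h
  have hent : ∀ i j a b, P i j * (1 : Matrix n n ℂ) a b + (1 : Matrix m m ℂ) i j * Q a b
      = X i j * Y a b := fun i j a b => by
    simpa using congrFun (congrFun hPQ (i, a)) (j, b)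
  by_cases h1 : ∃ a b, a ≠ b ∧ Y a b ≠ 0
  · obtain ⟨a, b, hab, hY⟩ := h1
    refine Or.inl ⟨Q a b / Y a b, ?_⟩
    ext i j
    have := hent i j a b
    rw [Matrix.one_apply_ne hab, mul_zero, zero_add] at this
    rw [Matrix.smul_apply, smul_eq_mul, div_mul_eq_mul_div, eq_div_iff hY, ← this, mul_comm]
  by_cases h2 : ∃ a b, Y a a ≠ Y b b
  · obtain ⟨a, b, hY⟩ := h2
    have hY' := sub_ne_zero.2 hY
    refine Or.inl ⟨(Q a a - Q b b) / (Y a a - Y b b), ?_⟩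
    ext i j
    have ha := hent i j a a
    have hb := hent i j b b
    rw [Matrix.one_apply_eq] at ha hb
    rw [Matrix.smul_apply, smul_eq_mul, div_mul_eq_mul_div, eq_div_iff hY']
    linear_combination hb - ha
  push Not at h1 h2
  right
  cases isEmpty_or_nonempty n with
  | inl _ => exact ⟨0, Subsingleton.elim _ _⟩
  | inr hn =>
    obtain ⟨a0⟩ := hn
    refine ⟨Y a0 a0, ?_⟩
    ext a b
    by_cases hab : a = b
    · subst hab; simp [h2 a a0]
    · simp [h1 a b hab, hab]

/-- A local sum whose square is a local sum lies in one of the two local algebras: the square of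
`X ⊗ 1 + 1 ⊗ Y` has the cross term `2 X ⊗ Y`. -/
theorem mem_leftLocal_or_mem_rightLocal {M : Matrix (m × n) (m × n) ℂ}
    (h1 : M ∈ localSum m n) (h2 : M * M ∈ localSum m n) :
    M ∈ leftLocal m n ∨ M ∈ rightLocal m n := by
  obtain ⟨X, Y, rfl⟩ := mem_localSum.1 h1
  have hXY : X ⊗ₖ Y ∈ localSum m n := by
    have h3 : X ⊗ₖ Y = (1 / 2 : ℂ) • ((X ⊗ₖ (1 : Matrix n n ℂ) + (1 : Matrix m m ℂ) ⊗ₖ Y) *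
        (X ⊗ₖ (1 : Matrix n n ℂ) + (1 : Matrix m m ℂ) ⊗ₖ Y) -
        ((X * X) ⊗ₖ (1 : Matrix n n ℂ) + (1 : Matrix m m ℂ) ⊗ₖ (Y * Y))) := by
      simp only [Matrix.add_mul, Matrix.mul_add, ← Matrix.mul_kronecker_mul, Matrix.one_mul,
        Matrix.mul_one]
      module
    rw [h3]
    exact Submodule.smul_mem _ _ (Submodule.sub_mem _ h2 (mem_localSum.2 ⟨_, _, rfl⟩))
  rcases exists_smul_one_of_kronecker_mem_localSum hXY with ⟨c, rfl⟩ | ⟨c, rfl⟩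
  · refine Or.inr (mem_rightLocal.2 ⟨c • 1 + Y, ?_⟩)
    rw [Matrix.kronecker_add, Matrix.smul_kronecker, Matrix.kronecker_smul]
  · refine Or.inl (mem_leftLocal.2 ⟨X + c • 1, ?_⟩)
    rw [Matrix.add_kronecker, Matrix.smul_kronecker, Matrix.kronecker_smul]

/-- A linear map that respects squares and has its values in the local sums has its image in one of the two
local algebras, since a vector space is not the union of two proper subspaces. -/
theorem forall_mem_leftLocal_or_forall_mem_rightLocal {R : Type*} [Ring R] [Module ℂ R]
    (f : R →ₗ[ℂ] Matrix (m × n) (m × n) ℂ) (hmul : ∀ x, f (x * x) = f x * f x)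
    (h : ∀ x, f x ∈ localSum m n) :
    (∀ x, f x ∈ leftLocal m n) ∨ ∀ x, f x ∈ rightLocal m n := by
  have h' : ∀ x, f x ∈ leftLocal m n ∨ f x ∈ rightLocal m n := fun x =>
    mem_leftLocal_or_mem_rightLocal (h x) (hmul x ▸ h (x * x))
  by_contra! hcon
  obtain ⟨⟨x, hx⟩, y, hy⟩ := hcon
  have hx' := (h' x).resolve_left hx
  have hy' := (h' y).resolve_right hy
  rcases h' (x + y) with hs | hs <;> rw [map_add] at hs
  · exact hx ((Submodule.add_mem_iff_left _ hy').1 hs)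
  · exact hy ((Submodule.add_mem_iff_right _ hx').1 hs)

/-- Conjugation by a matrix, as a linear map. -/
def conjLin {p : Type} [Fintype p] (V : Matrix p p ℂ) : Matrix p p ℂ →ₗ[ℂ] Matrix p p ℂ where
  toFun X := V * X * Vᴴ
  map_add' X Y := by rw [Matrix.mul_add, Matrix.add_mul]
  map_smul' c X := by simp

theorem conjLin_apply {p : Type} [Fintype p] (V X : Matrix p p ℂ) : conjLin V X = V * X * Vᴴ := rfl

theorem conjLin_mul_of_unitary {p : Type} [Fintype p] [DecidableEq p] {V : Matrix p p ℂ}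
    (hV : V ∈ Matrix.unitaryGroup p ℂ) (X Y : Matrix p p ℂ) :
    conjLin V (X * Y) = conjLin V X * conjLin V Y := by
  have hV2 : Vᴴ * V = 1 := Matrix.mem_unitaryGroup_iff'.1 hV
  simp only [conjLin_apply, Matrix.mul_assoc]
  rw [← Matrix.mul_assoc Vᴴ V, hV2, Matrix.one_mul]

theorem conjLin_injective_of_unitary {p : Type} [Fintype p] [DecidableEq p] {V : Matrix p p ℂ}
    (hV : V ∈ Matrix.unitaryGroup p ℂ) : Function.Injective (conjLin V) := by
  have hV2 : Vᴴ * V = 1 := Matrix.mem_unitaryGroup_iff'.1 hV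
  intro X Y h
  have := congrArg (fun M => Vᴴ * M * V) h
  simpa [conjLin_apply, Matrix.mul_assoc, hV2, ← Matrix.mul_assoc Vᴴ V] using this

/-- Conjugation by a unitary that maps `M_m ⊗ 1` to local sums maps it into one of the two local
algebras. -/
theorem conj_leftLocal_dichotomy {V : Matrix (m × n) (m × n) ℂ}
    (hV : V ∈ Matrix.unitaryGroup (m × n) ℂ)
    (h : ∀ X : Matrix m m ℂ, V * (X ⊗ₖ (1 : Matrix n n ℂ)) * Vᴴ ∈ localSum m n) :
    (∀ X : Matrix m m ℂ, V * (X ⊗ₖ (1 : Matrix n n ℂ)) * Vᴴ ∈ leftLocal m n) ∨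
      ∀ X : Matrix m m ℂ, V * (X ⊗ₖ (1 : Matrix n n ℂ)) * Vᴴ ∈ rightLocal m n :=
  forall_mem_leftLocal_or_forall_mem_rightLocal
    (conjLin V ∘ₗ leftEmb m n)
    (fun X => by
      change conjLin V ((X * X) ⊗ₖ 1) = conjLin V (X ⊗ₖ 1) * conjLin V (X ⊗ₖ 1)
      rw [← conjLin_mul_of_unitary hV, ← Matrix.mul_kronecker_mul, Matrix.one_mul]) h

theorem conj_rightLocal_dichotomy {V : Matrix (m × n) (m × n) ℂ}
    (hV : V ∈ Matrix.unitaryGroup (m × n) ℂ)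
    (h : ∀ Y : Matrix n n ℂ, V * ((1 : Matrix m m ℂ) ⊗ₖ Y) * Vᴴ ∈ localSum m n) :
    (∀ Y : Matrix n n ℂ, V * ((1 : Matrix m m ℂ) ⊗ₖ Y) * Vᴴ ∈ leftLocal m n) ∨
      ∀ Y : Matrix n n ℂ, V * ((1 : Matrix m m ℂ) ⊗ₖ Y) * Vᴴ ∈ rightLocal m n :=
  forall_mem_leftLocal_or_forall_mem_rightLocal
    (conjLin V ∘ₗ rightEmb m n)
    (fun Y => by
      change conjLin V (1 ⊗ₖ (Y * Y)) = conjLin V (1 ⊗ₖ Y) * conjLin V (1 ⊗ₖ Y)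
      rw [← conjLin_mul_of_unitary hV, ← Matrix.mul_kronecker_mul, Matrix.one_mul]) h

/-- Conjugation is injective, so the dimensions `m²` of `M_m ⊗ 1` and `n²` of `1 ⊗ M_n` compare. -/
theorem card_le_of_conj_leftLocal [Nonempty n] {V : Matrix (m × n) (m × n) ℂ}
    (hV : V ∈ Matrix.unitaryGroup (m × n) ℂ)
    (h : ∀ X : Matrix m m ℂ, V * (X ⊗ₖ (1 : Matrix n n ℂ)) * Vᴴ ∈ rightLocal m n) :
    Fintype.card m ≤ Fintype.card n := by
  have h1 := LinearMap.finrank_le_finrank_of_injective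
    (f := ((conjLin V ∘ₗ leftEmb m n).codRestrict
      (rightLocal m n) h)) (by
      intro X Y hXY
      exact kronecker_one_injective (conjLin_injective_of_unitary hV (congrArg Subtype.val hXY)))
  have h2 := h1.trans (LinearMap.finrank_range_le _)
  rw [Module.finrank_matrix, Module.finrank_matrix, Module.finrank_self, mul_one, mul_one] at h2
  exact Nat.mul_self_le_mul_self_iff.1 h2

theorem card_le_of_conj_rightLocal [Nonempty m] {V : Matrix (m × n) (m × n) ℂ}
    (hV : V ∈ Matrix.unitaryGroup (m × n) ℂ)
    (h : ∀ Y : Matrix n n ℂ, V * ((1 : Matrix m m ℂ) ⊗ₖ Y) * Vᴴ ∈ leftLocal m n) :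
    Fintype.card n ≤ Fintype.card m := by
  have h1 := LinearMap.finrank_le_finrank_of_injective
    (f := ((conjLin V ∘ₗ rightEmb m n).codRestrict
      (leftLocal m n) h)) (by
      intro X Y hXY
      exact one_kronecker_injective (conjLin_injective_of_unitary hV (congrArg Subtype.val hXY)))
  have h2 := h1.trans (LinearMap.finrank_range_le _)
  rw [Module.finrank_matrix, Module.finrank_matrix, Module.finrank_self, mul_one, mul_one] at h2
  exact Nat.mul_self_le_mul_self_iff.1 h2

end LocalAlgebras

/-! ### Normalizing elements preserve the local sums -/

section Normalizer

variable {m n : Type} [Fintype m] [DecidableEq m] [Fintype n] [DecidableEq n]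

/-- If `1 + w Q` is a product operator for two nonzero values of `w`, then `Q` is a local sum. The
`2 × 2` minors of a product operator vanish, and for `1 + w Q` they are polynomials in `w` without
constant term; the vanishing of their linear coefficients displays `Q` as a local sum. -/
theorem mem_localSum_of_one_add_smul [Nonempty m] [Nonempty n] {Q : Matrix (m × n) (m × n) ℂ}
    {w₁ w₂ : ℂ} (h1 : w₁ ≠ 0) (h2 : w₂ ≠ 0) (h12 : w₁ ≠ w₂)
    (hQ₁ : ∃ (C : Matrix m m ℂ) (D : Matrix n n ℂ), 1 + w₁ • Q = C ⊗ₖ D)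
    (hQ₂ : ∃ (C : Matrix m m ℂ) (D : Matrix n n ℂ), 1 + w₂ • Q = C ⊗ₖ D) :
    Q ∈ localSum m n := by
  obtain ⟨i0⟩ := ‹Nonempty m›
  obtain ⟨a0⟩ := ‹Nonempty n›
  have key : ∀ w : ℂ, w ≠ 0 → (∃ (C : Matrix m m ℂ) (D : Matrix n n ℂ), 1 + w • Q = C ⊗ₖ D) →
      ∀ i j a b, (Q (i, a) (j, b) + (1 : Matrix m m ℂ) i j * (1 : Matrix n n ℂ) a b *
          Q (i0, a0) (i0, a0) - Q (i, a0) (j, a0) * (1 : Matrix n n ℂ) a b -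
          (1 : Matrix m m ℂ) i j * Q (i0, a) (i0, b)) +
        w * (Q (i, a) (j, b) * Q (i0, a0) (i0, a0) - Q (i, a0) (j, a0) * Q (i0, a) (i0, b)) = 0 := by
    rintro w hw ⟨C, D, hCD⟩ i j a b
    have hent : ∀ i j a b, (1 : Matrix m m ℂ) i j * (1 : Matrix n n ℂ) a b + w * Q (i, a) (j, b)
        = C i j * D a b := fun i j a b => by
      have := congrFun (congrFun hCD (i, a)) (j, b)
      rw [← Matrix.one_kronecker_one] at this
      simpa only [Matrix.add_apply, Matrix.kroneckerMap_apply, Matrix.smul_apply,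
        smul_eq_mul] using this
    have e1 := hent i j a b
    have e2 := hent i0 i0 a0 a0
    have e3 := hent i j a0 a0
    have e4 := hent i0 i0 a b
    simp only [Matrix.one_apply_eq, mul_one, one_mul] at e2 e3 e4
    refine (mul_eq_zero.1 ?_).resolve_left hw
    linear_combination (1 + w * Q (i0, a0) (i0, a0)) * e1 + C i j * D a b * e2 -
      ((1 : Matrix n n ℂ) a b + w * Q (i0, a) (i0, b)) * e3 - C i j * D a0 a0 * e4
  refine mem_localSum.2 ⟨block Q a0 a0 - Q (i0, a0) (i0, a0) • 1,
    Q.submatrix (fun a => (i0, a)) (fun b => (i0, b)), ?_⟩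
  ext ⟨i, a⟩ ⟨j, b⟩
  have k1 := key w₁ h1 hQ₁ i j a b
  have k2 := key w₂ h2 hQ₂ i j a b
  simp only [Matrix.add_apply, Matrix.kroneckerMap_apply, Matrix.sub_apply, Matrix.smul_apply,
    smul_eq_mul, block, Matrix.submatrix_apply]
  refine mul_left_cancel₀ (sub_ne_zero.2 h12) ?_
  linear_combination w₂ * k1 - w₁ * k2

/-- The phase is a root of the determinant, of order the size of the matrix. -/
theorem exists_phase_mem_specialUnitaryGroup {p : Type} [Fintype p] [DecidableEq p] [Nonempty p]
    {A : Matrix p p ℂ} (hA : A ∈ Matrix.unitaryGroup p ℂ) :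
    ∃ c : ℂ, ‖c‖ = 1 ∧ ∃ A' : SU p, A = c • (A' : Matrix p p ℂ) := by
  have hdet : ‖A.det‖ = 1 := CStarRing.norm_of_mem_unitary (Matrix.det_of_mem_unitary hA)
  have hcard : Fintype.card p ≠ 0 := Fintype.card_ne_zero
  obtain ⟨c, hc⟩ := IsAlgClosed.exists_pow_nat_eq A.det (Nat.pos_of_ne_zero hcard)
  have hc1 : ‖c‖ = 1 := by
    rw [← pow_eq_one_iff_of_nonneg (norm_nonneg c) hcard, ← norm_pow, hc, hdet]
  have hc0 : c ≠ 0 := fun h => by simp [h] at hc1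
  have hcc : star c * c = 1 := by
    have := Complex.conj_mul' c
    rw [hc1] at this
    simpa using this
  have hA1 : A * Aᴴ = 1 := Matrix.mem_unitaryGroup_iff.1 hA
  refine ⟨c, hc1, ⟨c⁻¹ • A, Matrix.mem_specialUnitaryGroup_iff.2 ⟨?_, ?_⟩⟩, ?_⟩
  · rw [Matrix.mem_unitaryGroup_iff, Matrix.star_eq_conjTranspose, Matrix.conjTranspose_smul,
      Matrix.smul_mul, Matrix.mul_smul, hA1, smul_smul, star_inv₀, ← mul_inv, mul_comm, hcc,
      inv_one, one_smul]
  · rw [Matrix.det_smul, inv_pow, hc, inv_mul_cancel₀]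
    intro h
    rw [h, norm_zero] at hdet
    exact zero_ne_one hdet
  · rw [smul_smul, mul_inv_cancel₀ hc0, one_smul]

/-- The condition on `w` says that `1 + w` is a phase. -/
theorem one_add_smul_mem_unitaryGroup {p : Type} [Fintype p] [DecidableEq p] {P : Matrix p p ℂ}
    (hP : Pᴴ = P) (hPP : P * P = P) {w : ℂ} (hw : w + star w + w * star w = 0) :
    1 + w • P ∈ Matrix.unitaryGroup p ℂ := by
  rw [Matrix.mem_unitaryGroup_iff, Matrix.star_eq_conjTranspose, Matrix.conjTranspose_add,
    Matrix.conjTranspose_one, Matrix.conjTranspose_smul, hP]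
  simp only [Matrix.mul_add, Matrix.add_mul, Matrix.mul_smul, Matrix.smul_mul, hPP, Matrix.mul_one,
    Matrix.one_mul]
  have : (1 : Matrix p p ℂ) + w • P + star w • (P + w • P)
      = 1 + (w + star w + w * star w) • P := by module
  rw [this, hw, zero_smul, add_zero]

/-- Orthogonal projections span the matrices: `E_ij` is a combination of the projections to the
lines of the vectors `e_i`, `e_j`, `e_i + e_j` and `e_i - i e_j`. -/
theorem submodule_eq_top_of_projection_mem {p : Type} [Fintype p] [DecidableEq p]
    {S : Submodule ℂ (Matrix p p ℂ)} (h : ∀ P : Matrix p p ℂ, Pᴴ = P → P * P = P → P ∈ S) :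
    S = ⊤ := by
  have hd : ∀ i, Matrix.single i i (1 : ℂ) ∈ S := fun i =>
    h _ (by rw [Matrix.conjTranspose_single, star_one]) (by simp)
  have ho : ∀ i j, i ≠ j → ∀ z : ℂ, z * star z = 1 →
      (1 / 2 : ℂ) • (Matrix.single i i (1 : ℂ) + Matrix.single j j (1 : ℂ) + Matrix.single i j z +
        Matrix.single j i (star z)) ∈ S := fun i j hij z hz => by
    apply h
    · simp only [Matrix.conjTranspose_smul, Matrix.conjTranspose_add, Matrix.conjTranspose_single,
        star_one, star_star]
      rw [show star (1 / 2 : ℂ) = 1 / 2 by simp]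
      congr 1
      abel
    · have hz' : star z * z = 1 := by rw [mul_comm]; exact hz
      have h0 : ∀ (a b : p) (x y : ℂ), Matrix.single a i x * Matrix.single j b y = 0 :=
        fun a b x y => by simp [hij]
      have h0' : ∀ (a b : p) (x y : ℂ), Matrix.single a j x * Matrix.single i b y = 0 :=
        fun a b x y => by simp [hij.symm]
      simp only [Matrix.smul_mul, Matrix.mul_smul, Matrix.add_mul, Matrix.mul_add,
        Matrix.single_mul_single_same, h0, h0', hz, hz', one_mul, mul_one, add_zero,
        zero_add]
      module
  rw [eq_top_iff]
  intro M _
  rw [Matrix.matrix_eq_sum_single M]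
  refine Submodule.sum_mem _ fun i _ => Submodule.sum_mem _ fun j _ => ?_
  have hs : ∀ (i j : p) (c : ℂ), Matrix.single i j c = c • Matrix.single i j (1 : ℂ) :=
    fun i j c => by rw [Matrix.smul_single, smul_eq_mul, mul_one]
  rw [hs]
  apply S.smul_mem
  by_cases hij : i = j
  · subst hij
    exact hd i
  have h1 := ho i j hij 1 (by simp)
  have h2 := ho i j hij Complex.I (by simp)
  rw [hs i j Complex.I, hs j i (star Complex.I), Complex.star_def, Complex.conj_I] at h2
  rw [star_one] at h1
  have e : Matrix.single i j (1 : ℂ) =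
      (1 / 2 : ℂ) • (((2 : ℂ) • (1 / 2 : ℂ) • (Matrix.single i i (1 : ℂ) + Matrix.single j j (1 : ℂ) +
        Matrix.single i j (1 : ℂ) + Matrix.single j i (1 : ℂ)) - Matrix.single i i (1 : ℂ) -
        Matrix.single j j (1 : ℂ)) - Complex.I • ((2 : ℂ) • (1 / 2 : ℂ) •
        (Matrix.single i i (1 : ℂ) + Matrix.single j j (1 : ℂ) +
        Complex.I • Matrix.single i j (1 : ℂ) + (-Complex.I) • Matrix.single j i (1 : ℂ)) -
        Matrix.single i i (1 : ℂ) - Matrix.single j j (1 : ℂ))) := by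
    match_scalars <;> ring_nf <;> norm_num [Complex.I_sq]
  rw [e]
  exact S.smul_mem _ (S.sub_mem (S.sub_mem (S.sub_mem (S.smul_mem _ h1) (hd i)) (hd j))
    (S.smul_mem _ (S.sub_mem (S.sub_mem (S.smul_mem _ h2) (hd i)) (hd j))))

theorem coe_inv_SU {p : Type} [Fintype p] [DecidableEq p] (g : SU p) :
    ((g⁻¹ : SU p) : Matrix p p ℂ) = (g : Matrix p p ℂ)ᴴ := rfl

/-- An element `V` of the normalizer maps `A ⊗ B`, for unitary `A` and `B`, to a product
operator: products are stable under rescaling to determinant one. -/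
theorem exists_kronecker_of_mem_normalizer [Nonempty m] [Nonempty n] {V : SU (m × n)}
    (hV : V ∈ Subgroup.normalizer (productSU m n : Set (SU (m × n)))) {A : Matrix m m ℂ}
    (hA : A ∈ Matrix.unitaryGroup m ℂ) {B : Matrix n n ℂ} (hB : B ∈ Matrix.unitaryGroup n ℂ) :
    ∃ (C : Matrix m m ℂ) (D : Matrix n n ℂ),
      (V : Matrix (m × n) (m × n) ℂ) * (A ⊗ₖ B) * (V : Matrix (m × n) (m × n) ℂ)ᴴ = C ⊗ₖ D := by
  obtain ⟨c, -, A', rfl⟩ := exists_phase_mem_specialUnitaryGroup hA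
  obtain ⟨d, -, B', rfl⟩ := exists_phase_mem_specialUnitaryGroup hB
  obtain ⟨⟨C, D⟩, hCD⟩ := (Subgroup.mem_normalizer_iff.1 hV (tensorHom m n (A', B'))).1 ⟨_, rfl⟩
  have h : (C : Matrix m m ℂ) ⊗ₖ (D : Matrix n n ℂ) = (V : Matrix (m × n) (m × n) ℂ) *
      ((A' : Matrix m m ℂ) ⊗ₖ (B' : Matrix n n ℂ)) * (V : Matrix (m × n) (m × n) ℂ)ᴴ :=
    congrArg Subtype.val hCD
  refine ⟨(c * d) • (C : Matrix m m ℂ), D, ?_⟩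
  rw [Matrix.smul_kronecker (c * d) (C : Matrix m m ℂ), h]
  simp [Matrix.smul_kronecker, Matrix.kronecker_smul, smul_smul, mul_comm]

theorem conj_one_add_smul {p : Type} [Fintype p] [DecidableEq p] (V : SU p) (w : ℂ)
    (P : Matrix p p ℂ) : (V : Matrix p p ℂ) * (1 + w • P) * (V : Matrix p p ℂ)ᴴ =
      1 + w • ((V : Matrix p p ℂ) * P * (V : Matrix p p ℂ)ᴴ) := by
  have h : (V : Matrix p p ℂ) * (V : Matrix p p ℂ)ᴴ = 1 := mul_eq_one_comm.1 (SU.star_mul_self V)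
  rw [Matrix.mul_add, Matrix.add_mul, Matrix.mul_one, h, Matrix.mul_smul, Matrix.smul_mul]

/-- Conjugation by a normalizing element preserves the local sums. It is enough to consider
`P ⊗ 1` for a projection `P`, and then `1 + (z - 1) P` is unitary for every phase `z`; the phases
`-1` and `i` suffice. -/
theorem conj_leftLocal_of_mem_normalizer [Nonempty m] [Nonempty n] {V : SU (m × n)}
    (hV : V ∈ Subgroup.normalizer (productSU m n : Set (SU (m × n)))) (X : Matrix m m ℂ) :
    (V : Matrix (m × n) (m × n) ℂ) * (X ⊗ₖ (1 : Matrix n n ℂ)) *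
      (V : Matrix (m × n) (m × n) ℂ)ᴴ ∈ localSum m n := by
  have htop : (localSum m n).comap (conjLin (V : Matrix (m × n) (m × n) ℂ) ∘ₗ leftEmb m n) = ⊤ := by
    apply submodule_eq_top_of_projection_mem
    intro P hP hPP
    have h : ∀ w : ℂ, w + star w + w * star w = 0 → ∃ (C : Matrix m m ℂ) (D : Matrix n n ℂ),
        1 + w • ((V : Matrix (m × n) (m × n) ℂ) * (P ⊗ₖ (1 : Matrix n n ℂ)) *
          (V : Matrix (m × n) (m × n) ℂ)ᴴ) = C ⊗ₖ D := fun w hw => by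
      rw [← conj_one_add_smul, ← Matrix.smul_kronecker, ← Matrix.one_kronecker_one,
        ← Matrix.add_kronecker]
      exact exists_kronecker_of_mem_normalizer hV (one_add_smul_mem_unitaryGroup hP hPP hw)
        (one_mem _)
    refine mem_localSum_of_one_add_smul (w₁ := -2) (w₂ := Complex.I - 1) (by norm_num) ?_ ?_
      (h _ ?_) (h _ ?_)
    · exact fun h => by simpa using congrArg Complex.im h
    · exact fun h => by simpa using congrArg Complex.im h
    · norm_num
    · simp [Complex.ext_iff]
  exact htop.ge (Submodule.mem_top (x := X))

theorem conj_rightLocal_of_mem_normalizer [Nonempty m] [Nonempty n] {V : SU (m × n)}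
    (hV : V ∈ Subgroup.normalizer (productSU m n : Set (SU (m × n)))) (Y : Matrix n n ℂ) :
    (V : Matrix (m × n) (m × n) ℂ) * ((1 : Matrix m m ℂ) ⊗ₖ Y) *
      (V : Matrix (m × n) (m × n) ℂ)ᴴ ∈ localSum m n := by
  have htop : (localSum m n).comap (conjLin (V : Matrix (m × n) (m × n) ℂ) ∘ₗ rightEmb m n) = ⊤ := by
    apply submodule_eq_top_of_projection_mem
    intro P hP hPP
    have h : ∀ w : ℂ, w + star w + w * star w = 0 → ∃ (C : Matrix m m ℂ) (D : Matrix n n ℂ),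
        1 + w • ((V : Matrix (m × n) (m × n) ℂ) * ((1 : Matrix m m ℂ) ⊗ₖ P) *
          (V : Matrix (m × n) (m × n) ℂ)ᴴ) = C ⊗ₖ D := fun w hw => by
      rw [← conj_one_add_smul, ← Matrix.kronecker_smul, ← Matrix.one_kronecker_one,
        ← Matrix.kronecker_add]
      exact exists_kronecker_of_mem_normalizer hV (one_mem _)
        (one_add_smul_mem_unitaryGroup hP hPP hw)
    refine mem_localSum_of_one_add_smul (w₁ := -2) (w₂ := Complex.I - 1) (by norm_num) ?_ ?_
      (h _ ?_) (h _ ?_)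
    · exact fun h => by simpa using congrArg Complex.im h
    · exact fun h => by simpa using congrArg Complex.im h
    · norm_num
    · simp [Complex.ext_iff]
  exact htop.ge (Submodule.mem_top (x := Y))

theorem conj_localSum_of_mem_normalizer [Nonempty m] [Nonempty n] {V : SU (m × n)}
    (hV : V ∈ Subgroup.normalizer (productSU m n : Set (SU (m × n))))
    {M : Matrix (m × n) (m × n) ℂ} (hM : M ∈ localSum m n) :
    (V : Matrix (m × n) (m × n) ℂ) * M * (V : Matrix (m × n) (m × n) ℂ)ᴴ ∈ localSum m n := by
  obtain ⟨X, Y, rfl⟩ := mem_localSum.1 hM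
  rw [Matrix.mul_add, Matrix.add_mul]
  exact add_mem (conj_leftLocal_of_mem_normalizer hV X) (conj_rightLocal_of_mem_normalizer hV Y)

end Normalizer

/-! ### Burnside's theorem and the adjoint representation -/

section Burnside

/-- **Burnside's theorem**: the operators of an irreducible representation span all
endomorphisms. -/
theorem asAlgebraHom_surjective_of_isIrreducible {G V : Type*} [Group G] [AddCommGroup V]
    [Module ℂ V] [FiniteDimensional ℂ V] {ρ : Representation ℂ G V} (hρ : ρ.IsIrreducible) :
    Function.Surjective ρ.asAlgebraHom := by
  intro f
  have hs : IsSimpleModule (MonoidAlgebra ℂ G) ρ.asModule :=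
    (Representation.irreducible_iff_isSimpleModule_asModule ρ).1 hρ
  have hfin : FiniteDimensional ℂ ρ.asModule := ‹FiniteDimensional ℂ V›
  -- By Schur's lemma every linear endomorphism commutes with the commutant.
  let F : Module.End (Module.End (MonoidAlgebra ℂ G) ρ.asModule) ρ.asModule :=
    { toFun := f
      map_add' := f.map_add
      map_smul' := fun φ x => by
        obtain ⟨c, rfl⟩ := (IsSimpleModule.algebraMap_end_bijective_of_isAlgClosed
          (A := MonoidAlgebra ℂ G) (V := ρ.asModule) ℂ).2 φ
        exact f.map_smul c x }
  obtain ⟨s, hs⟩ := Module.Finite.fg_top (R := ℂ) (M := V)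
  obtain ⟨r, hr⟩ := jacobson_density F s
  refine ⟨r, LinearMap.ext_on hs fun x hx => ?_⟩
  exact (hr x hx).symm

/-- A character of an algebra does not factor through a surjection to a matrix algebra of size at
least two. -/
theorem exists_map_eq_zero_and_eq_one {R p : Type*} [Ring R] [Algebra ℂ R] [Fintype p]
    [DecidableEq p] [Nontrivial p] (θ : R →ₐ[ℂ] Matrix p p ℂ) (hθ : Function.Surjective θ)
    (ε : R →ₐ[ℂ] ℂ) : ∃ r, θ r = 0 ∧ ε r = 1 := by
  by_contra! hcon
  have hker : ∀ r, θ r = 0 → ε r = 0 := fun r hr => by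
    by_contra h0
    exact hcon ((ε r)⁻¹ • r) (by rw [map_smul, hr, smul_zero])
      (by rw [map_smul, smul_eq_mul, inv_mul_cancel₀ h0])
  choose r hr using fun i j => hθ (Matrix.single i j (1 : ℂ))
  -- `E_ij` is nilpotent for `i ≠ j`, and `E_ii = E_ij E_ji`.
  have hoff : ∀ i j, i ≠ j → ε (r i j) = 0 := fun i j hij => by
    have := hker (r i j * r i j) (by
      rw [map_mul, hr, Matrix.single_mul_single_of_ne (h := hij.symm)])
    rw [map_mul] at this
    exact mul_self_eq_zero.1 this
  have hdiag : ∀ i, ε (r i i) = 0 := fun i => by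
    obtain ⟨j, hj⟩ := exists_ne i
    have := hker (r i i - r i j * r j i) (by
      rw [map_sub, map_mul, hr, hr, hr, Matrix.single_mul_single_same, one_mul, sub_self])
    rwa [map_sub, map_mul, hoff i j hj.symm, zero_mul, sub_zero] at this
  have h1 := hker (1 - ∑ i, r i i) (by
    rw [map_sub, map_one, map_sum]
    simp only [hr]
    rw [Matrix.sum_single_one, sub_self])
  rw [map_sub, map_one, map_sum, Finset.sum_eq_zero fun i _ => hdiag i, sub_zero] at h1
  exact one_ne_zero h1

end Burnside

section Adjoint

variable {n : Type} [Fintype n] [DecidableEq n]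

/-- The conjugation action of `SU(n)` on all `n × n` matrices. -/
def conjRep (n : Type) [Fintype n] [DecidableEq n] : Representation ℂ (SU n) (Matrix n n ℂ) where
  toFun g := conjLin (g : Matrix n n ℂ)
  map_one' := by
    ext1 X
    simp [conjLin_apply]
  map_mul' g h := by
    ext1 X
    simp [conjLin_apply, Matrix.conjTranspose_mul, Matrix.mul_assoc]

/-- A linear map of matrices that preserves the decomposition into scalar and traceless matrices. -/
def PreservesTraceSplitting (T : Matrix n n ℂ →ₗ[ℂ] Matrix n n ℂ) : Prop :=
  (∃ c : ℂ, T 1 = c • (1 : Matrix n n ℂ)) ∧ ∀ X, X.trace = 0 → (T X).trace = 0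

/-- `X - (tr X / n) 1`. -/
noncomputable def tracelessPart : Matrix n n ℂ →ₗ[ℂ] Matrix n n ℂ where
  toFun X := X - (X.trace / Fintype.card n) • (1 : Matrix n n ℂ)
  map_add' X Y := by rw [Matrix.trace_add, add_div]; module
  map_smul' c X := by
    rw [Matrix.trace_smul, smul_eq_mul, mul_div_assoc, RingHom.id_apply, smul_sub, smul_smul]

theorem tracelessPart_apply (X : Matrix n n ℂ) :
    tracelessPart X = X - (X.trace / Fintype.card n) • (1 : Matrix n n ℂ) := rfl

theorem trace_tracelessPart [Nonempty n] (X : Matrix n n ℂ) : (tracelessPart X).trace = 0 := by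
  have : (Fintype.card n : ℂ) ≠ 0 := Nat.cast_ne_zero.2 Fintype.card_ne_zero
  rw [tracelessPart_apply, Matrix.trace_sub, Matrix.trace_smul, Matrix.trace_one, smul_eq_mul,
    div_mul_cancel₀ _ this, sub_self]

theorem tracelessPart_one [Nonempty n] : tracelessPart (1 : Matrix n n ℂ) = 0 := by
  have : (Fintype.card n : ℂ) ≠ 0 := Nat.cast_ne_zero.2 Fintype.card_ne_zero
  rw [tracelessPart_apply, Matrix.trace_one, div_self this, one_smul, sub_self]

/-- Every matrix is the sum of a traceless and a scalar one. -/
theorem linearMap_ext_traceless [Nonempty n] {T T' : Matrix n n ℂ →ₗ[ℂ] Matrix n n ℂ}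
    (h1 : T 1 = T' 1) (h2 : ∀ X, X.trace = 0 → T X = T' X) : T = T' := by
  ext1 X
  have hX : X = tracelessPart X + (X.trace / Fintype.card n) • (1 : Matrix n n ℂ) := by
    rw [tracelessPart_apply, sub_add_cancel]
  rw [hX, map_add, map_add, map_smul, map_smul, h1, h2 _ (trace_tracelessPart X)]

theorem conjRep_asAlgebraHom_coe (G : Subgroup (SU n)) (r : MonoidAlgebra ℂ G) (X : slC n) :
    Representation.asAlgebraHom ((conjRep n).comp G.subtype) r (X : Matrix n n ℂ) =
      ((Representation.asAlgebraHom ((adRep n).comp G.subtype) r X : slC n) : Matrix n n ℂ) := by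
  induction r using MonoidAlgebra.induction_linear with
  | zero => simp
  | add r s hr hs => simp only [map_add, LinearMap.add_apply, hr, hs]; rfl
  | single g c =>
    simp only [Representation.asAlgebraHom_single, LinearMap.smul_apply]
    rfl

theorem conjRep_asAlgebraHom_one (G : Subgroup (SU n)) (r : MonoidAlgebra ℂ G) :
    Representation.asAlgebraHom ((conjRep n).comp G.subtype) r (1 : Matrix n n ℂ) =
      (MonoidAlgebra.lift ℂ ℂ G (1 : G →* ℂ) r) • (1 : Matrix n n ℂ) := by
  induction r using MonoidAlgebra.induction_linear with
  | zero => simp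
  | add r s hr hs => simp only [map_add, LinearMap.add_apply, hr, hs, add_smul]
  | single g c =>
    have h : ((g : SU n) : Matrix n n ℂ) * ((g : SU n) : Matrix n n ℂ)ᴴ = 1 :=
      mul_eq_one_comm.1 (SU.star_mul_self _)
    simp only [Representation.asAlgebraHom_single, LinearMap.smul_apply, MonoidAlgebra.lift_single,
      MonoidHom.one_apply, smul_eq_mul, mul_one]
    congr 1
    change ((g : SU n) : Matrix n n ℂ) * 1 * ((g : SU n) : Matrix n n ℂ)ᴴ = 1
    rw [Matrix.mul_one, h]

theorem one_lt_finrank_slC [Nontrivial n] : 1 < Module.finrank ℂ (slC n) := by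
  obtain ⟨i, j, hij⟩ := exists_pair_ne n
  by_contra! hle
  let x : slC n := ⟨Matrix.single i j 1, (mem_slC_iff _).2 (Matrix.trace_single_eq_of_ne i j _ hij)⟩
  let y : slC n :=
    ⟨Matrix.single j i 1, (mem_slC_iff _).2 (Matrix.trace_single_eq_of_ne j i _ hij.symm)⟩
  have hx : x ≠ 0 := fun h => by
    have := congrFun (congrFun (congrArg Subtype.val h) i) j
    simp [x] at this
  obtain ⟨v, hv⟩ := finrank_le_one_iff.1 hle
  obtain ⟨a, ha⟩ := hv x
  obtain ⟨b, hb⟩ := hv y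
  have ha0 : a ≠ 0 := fun h => hx (by rw [← ha, h, zero_smul])
  have hyx : y = (b / a) • x := by rw [← ha, ← hb, smul_smul, div_mul_cancel₀ _ ha0]
  have := congrFun (congrFun (congrArg Subtype.val hyx) j) i
  simp [x, y, hij] at this

/-- If `G` acts irreducibly on `𝔰𝔩(n, ℂ)`, its operators on `M_n = ℂ 1 ⊕ 𝔰𝔩(n, ℂ)` span all linear
maps that preserve this decomposition: Burnside's theorem gives the maps of the second summand, and
the first is separated from it because it has another dimension. -/
theorem exists_asAlgebraHom_eq [Nontrivial n] {G : Subgroup (SU n)} (hG : AdjointIrreducible G)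
    {T : Matrix n n ℂ →ₗ[ℂ] Matrix n n ℂ} (hT : PreservesTraceSplitting T) :
    ∃ r, Representation.asAlgebraHom ((conjRep n).comp G.subtype) r = T := by
  obtain ⟨⟨c, hc⟩, hT⟩ := hT
  have hsurj := asAlgebraHom_surjective_of_isIrreducible hG
  have : Nontrivial (Fin (Module.finrank ℂ (slC n))) := Fin.nontrivial_iff_two_le.2 one_lt_finrank_slC
  let φ := algEquivMatrix (Module.finBasis ℂ (slC n))
  -- `e` acts as zero on `𝔰𝔩(n, ℂ)` and as one on the scalars.
  obtain ⟨e, he, he1⟩ := exists_map_eq_zero_and_eq_one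
    (φ.toAlgHom.comp (Representation.asAlgebraHom ((adRep n).comp G.subtype)))
    (φ.surjective.comp hsurj) (MonoidAlgebra.lift ℂ ℂ G (1 : G →* ℂ))
  replace he : Representation.asAlgebraHom ((adRep n).comp G.subtype) e = 0 :=
    φ.injective (he.trans (map_zero φ).symm)
  let T₀ : slC n →ₗ[ℂ] slC n :=
    { toFun := fun X => ⟨T X, hT X X.2⟩
      map_add' := fun X Y => Subtype.ext (T.map_add X Y)
      map_smul' := fun c X => Subtype.ext (T.map_smul c X) }
  obtain ⟨r, hr⟩ := hsurj T₀
  refine ⟨r * (1 - e) + c • e, linearMap_ext_traceless ?_ fun X hX => ?_⟩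
  · rw [conjRep_asAlgebraHom_one, hc]
    simp [he1]
  · rw [conjRep_asAlgebraHom_coe G _ ⟨X, hX⟩, map_add, map_mul, map_sub, map_smul, he, map_one,
      sub_zero, mul_one, smul_zero, add_zero, hr]
    rfl

end Adjoint

/-! ### Subspaces stable under lifted operators -/

section Lifts

variable {m n : Type} [Fintype m] [DecidableEq m] [Fintype n] [DecidableEq n]

/-- `T ⊗ id` on `M_m ⊗ M_n`, acting block by block. -/
def leftLift : (Matrix m m ℂ →ₗ[ℂ] Matrix m m ℂ) →ₗ[ℂ]
    (Matrix (m × n) (m × n) ℂ →ₗ[ℂ] Matrix (m × n) (m × n) ℂ) where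
  toFun T :=
    { toFun := fun M => Matrix.of fun p q => T (block M p.2 q.2) p.1 q.1
      map_add' := fun M N => by
        ext p q
        change T (block M p.2 q.2 + block N p.2 q.2) p.1 q.1 = _
        rw [map_add]; rfl
      map_smul' := fun c M => by
        ext p q
        change T (c • block M p.2 q.2) p.1 q.1 = _
        rw [map_smul]; rfl }
  map_add' _ _ := rfl
  map_smul' _ _ := rfl

/-- `id ⊗ T` on `M_m ⊗ M_n`. -/
def rightLift : (Matrix n n ℂ →ₗ[ℂ] Matrix n n ℂ) →ₗ[ℂ]
    (Matrix (m × n) (m × n) ℂ →ₗ[ℂ] Matrix (m × n) (m × n) ℂ) where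
  toFun T :=
    { toFun := fun M => Matrix.of fun p q =>
        T (block (M.submatrix Prod.swap Prod.swap) p.1 q.1) p.2 q.2
      map_add' := fun M N => by
        ext p q
        change T (block (M.submatrix Prod.swap Prod.swap) p.1 q.1 +
          block (N.submatrix Prod.swap Prod.swap) p.1 q.1) p.2 q.2 = _
        rw [map_add]; rfl
      map_smul' := fun c M => by
        ext p q
        change T (c • block (M.submatrix Prod.swap Prod.swap) p.1 q.1) p.2 q.2 = _
        rw [map_smul]; rfl }
  map_add' _ _ := rfl
  map_smul' _ _ := rfl

theorem leftLift_kronecker (T : Matrix m m ℂ →ₗ[ℂ] Matrix m m ℂ) (X : Matrix m m ℂ)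
    (Y : Matrix n n ℂ) : leftLift T (X ⊗ₖ Y) = T X ⊗ₖ Y := by
  ext ⟨i, a⟩ ⟨j, b⟩
  have h : block (X ⊗ₖ Y) a b = Y a b • X := by
    ext i j
    simp [block, mul_comm]
  change T (block (X ⊗ₖ Y) a b) i j = T X i j * Y a b
  rw [h, map_smul, Matrix.smul_apply, smul_eq_mul, mul_comm]

theorem rightLift_kronecker (T : Matrix n n ℂ →ₗ[ℂ] Matrix n n ℂ) (X : Matrix m m ℂ)
    (Y : Matrix n n ℂ) : rightLift T (X ⊗ₖ Y) = X ⊗ₖ T Y := by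
  ext ⟨i, a⟩ ⟨j, b⟩
  have h : block (Y ⊗ₖ X) i j = X i j • Y := by
    ext a b
    simp [block, mul_comm]
  change T (block ((X ⊗ₖ Y).submatrix Prod.swap Prod.swap) i j) a b = X i j * T Y a b
  rw [submatrix_swap_kronecker, h, map_smul, Matrix.smul_apply, smul_eq_mul]

theorem eq_top_of_kronecker_mem {S : Submodule ℂ (Matrix (m × n) (m × n) ℂ)}
    (h : ∀ (X : Matrix m m ℂ) (Y : Matrix n n ℂ), X ⊗ₖ Y ∈ S) : S = ⊤ := by
  rw [eq_top_iff]
  intro M _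
  rw [Matrix.matrix_eq_sum_single M]
  refine Submodule.sum_mem _ fun p _ => Submodule.sum_mem _ fun q _ => ?_
  rw [← mul_one (M p q), ← Matrix.single_kronecker_single]
  exact h _ _

theorem linearMap_ext_kronecker {E : Type*} [AddCommGroup E] [Module ℂ E]
    {f g : Matrix (m × n) (m × n) ℂ →ₗ[ℂ] E}
    (h : ∀ (X : Matrix m m ℂ) (Y : Matrix n n ℂ), f (X ⊗ₖ Y) = g (X ⊗ₖ Y)) : f = g := by
  have := eq_top_of_kronecker_mem (S := LinearMap.eqLocus f g) h
  exact LinearMap.eqLocus_eq_top.1 this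

theorem leftLift_conjLin (A : Matrix m m ℂ) :
    leftLift (conjLin A) = conjLin (A ⊗ₖ (1 : Matrix n n ℂ)) :=
  linearMap_ext_kronecker fun X Y => by
    rw [leftLift_kronecker, conjLin_apply, conjLin_apply, Matrix.conjTranspose_kronecker,
      ← Matrix.mul_kronecker_mul, ← Matrix.mul_kronecker_mul, Matrix.conjTranspose_one,
      Matrix.one_mul, Matrix.mul_one]

theorem rightLift_conjLin (B : Matrix n n ℂ) :
    rightLift (conjLin B) = conjLin ((1 : Matrix m m ℂ) ⊗ₖ B) :=
  linearMap_ext_kronecker fun X Y => by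
    rw [rightLift_kronecker, conjLin_apply, conjLin_apply, Matrix.conjTranspose_kronecker,
      ← Matrix.mul_kronecker_mul, ← Matrix.mul_kronecker_mul, Matrix.conjTranspose_one,
      Matrix.one_mul, Matrix.mul_one]

/-- The operator `X ↦ (X - (tr X / n) 1)_{ij} Y`. -/
noncomputable def entryOp (i j : n) (Y : Matrix n n ℂ) : Matrix n n ℂ →ₗ[ℂ] Matrix n n ℂ :=
  ((Matrix.entryLinearMap ℂ ℂ i j) ∘ₗ tracelessPart).smulRight Y

theorem entryOp_apply (i j : n) (Y X : Matrix n n ℂ) :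
    entryOp i j Y X = tracelessPart X i j • Y := rfl

theorem preservesTraceSplitting_entryOp [Nonempty n] (i j : n) {Y : Matrix n n ℂ}
    (hY : Y.trace = 0) : PreservesTraceSplitting (entryOp i j Y) :=
  ⟨⟨0, by rw [entryOp_apply, tracelessPart_one, Matrix.zero_apply, zero_smul, zero_smul]⟩,
    fun X _ => by rw [entryOp_apply, Matrix.trace_smul, hY, smul_zero]⟩

/-- Stability of `W` under `T ⊗ id` and `id ⊗ T` for all `T` that preserve the decomposition of
matrices into scalar and traceless ones. -/
structure IsLiftStable (W : Submodule ℂ (Matrix (m × n) (m × n) ℂ)) : Prop where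
  left : ∀ T : Matrix m m ℂ →ₗ[ℂ] Matrix m m ℂ, PreservesTraceSplitting T →
    ∀ M ∈ W, leftLift T M ∈ W
  right : ∀ T : Matrix n n ℂ →ₗ[ℂ] Matrix n n ℂ, PreservesTraceSplitting T →
    ∀ M ∈ W, rightLift T M ∈ W

/-- `Ad_A ⊗ id` is conjugation by `A ⊗ 1`, and the operators `Ad_A` span the relevant `T`. -/
theorem isLiftStable_of_adjointIrreducible [Nontrivial m] [Nontrivial n] {G : Subgroup (SU m)}
    (hG : AdjointIrreducible G) {H : Subgroup (SU n)} (hH : AdjointIrreducible H)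
    {W : Submodule ℂ (Matrix (m × n) (m × n) ℂ)}
    (hGW : ∀ g ∈ G, ∀ M ∈ W, conjLin ((g : Matrix m m ℂ) ⊗ₖ (1 : Matrix n n ℂ)) M ∈ W)
    (hHW : ∀ h ∈ H, ∀ M ∈ W, conjLin ((1 : Matrix m m ℂ) ⊗ₖ (h : Matrix n n ℂ)) M ∈ W) :
    IsLiftStable W where
  left T hT M hM := by
    obtain ⟨r, rfl⟩ := exists_asAlgebraHom_eq hG hT
    clear hT
    induction r using MonoidAlgebra.induction_linear with
    | zero => simp
    | add r s hr hs =>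
      rw [map_add, map_add]
      exact W.add_mem hr hs
    | single g c =>
      rw [Representation.asAlgebraHom_single, map_smul]
      refine W.smul_mem _ ?_
      change leftLift (conjLin ((g : SU m) : Matrix m m ℂ)) M ∈ W
      rw [leftLift_conjLin]
      exact hGW g g.2 M hM
  right T hT M hM := by
    obtain ⟨r, rfl⟩ := exists_asAlgebraHom_eq hH hT
    clear hT
    induction r using MonoidAlgebra.induction_linear with
    | zero => simp
    | add r s hr hs =>
      rw [map_add, map_add]
      exact W.add_mem hr hs
    | single g c =>
      rw [Representation.asAlgebraHom_single, map_smul]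
      refine W.smul_mem _ ?_
      change rightLift (conjLin ((g : SU n) : Matrix n n ℂ)) M ∈ W
      rw [rightLift_conjLin]
      exact hHW g g.2 M hM

/-- The traceless products form an irreducible summand: a stable subspace contains all of it unless
its component in this summand vanishes. -/
theorem IsLiftStable.le_localSum_or_kronecker_mem [Nonempty m] [Nonempty n]
    {W : Submodule ℂ (Matrix (m × n) (m × n) ℂ)} (hW : IsLiftStable W) :
    W ≤ localSum m n ∨ ∀ (X : Matrix m m ℂ) (Y : Matrix n n ℂ), X.trace = 0 → Y.trace = 0 →
      X ⊗ₖ Y ∈ W := by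
  rw [or_iff_not_imp_left, SetLike.not_le_iff_exists]
  rintro ⟨w, hw, hwE⟩ X Y hX hY
  obtain ⟨⟨i, a⟩, ⟨j, b⟩, hu⟩ : ∃ p q : m × n,
      leftLift tracelessPart (rightLift tracelessPart w) p q ≠ 0 := by
    by_contra! h0
    have h0' : leftLift tracelessPart (rightLift tracelessPart w) = 0 := Matrix.ext h0
    have hcomp := eq_top_of_kronecker_mem (S := (localSum m n).comap
      (LinearMap.id - leftLift tracelessPart ∘ₗ rightLift tracelessPart)) fun X Y => by
        rw [Submodule.mem_comap, LinearMap.sub_apply, LinearMap.comp_apply, rightLift_kronecker,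
          leftLift_kronecker, LinearMap.id_apply]
        refine mem_localSum.2 ⟨(Y.trace / Fintype.card n) • X, (X.trace / Fintype.card m) •
          (Y - (Y.trace / Fintype.card n) • 1), ?_⟩
        simp only [tracelessPart_apply, sub_eq_add_neg, Matrix.add_kronecker, Matrix.kronecker_add,
          ← neg_smul, Matrix.smul_kronecker, Matrix.kronecker_smul]
        module
    have := hcomp.ge (Submodule.mem_top (x := w))
    rw [Submodule.mem_comap, LinearMap.sub_apply, LinearMap.comp_apply, h0', sub_zero] at this
    exact hwE this
  have hop : leftLift (entryOp i j X) ∘ₗ rightLift (entryOp a b Y) =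
      ((Matrix.entryLinearMap ℂ ℂ (i, a) (j, b)) ∘ₗ leftLift tracelessPart ∘ₗ
        rightLift tracelessPart).smulRight (X ⊗ₖ Y) := by
    apply linearMap_ext_kronecker
    intro P Q
    rw [LinearMap.smulRight_apply, LinearMap.comp_apply, LinearMap.comp_apply, LinearMap.comp_apply,
      rightLift_kronecker, leftLift_kronecker, rightLift_kronecker, leftLift_kronecker,
      entryOp_apply, entryOp_apply, Matrix.smul_kronecker, Matrix.kronecker_smul, smul_smul]
    rfl
  have hmem := hW.left _ (preservesTraceSplitting_entryOp i j hX) _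
    (hW.right _ (preservesTraceSplitting_entryOp a b hY) _ hw)
  rw [← LinearMap.comp_apply, hop] at hmem
  exact (W.smul_mem_iff hu).1 hmem

/-- The summand `𝔰𝔩(m) ⊗ 1` is irreducible: apply `entryOp` to a nonzero component in it. -/
theorem IsLiftStable.kronecker_one_mem_or_le [Nonempty m] [Nonempty n]
    {W : Submodule ℂ (Matrix (m × n) (m × n) ℂ)} (hW : IsLiftStable W) (hE : W ≤ localSum m n) :
    (∀ X : Matrix m m ℂ, X.trace = 0 → X ⊗ₖ (1 : Matrix n n ℂ) ∈ W) ∨ W ≤ rightLocal m n := by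
  rw [or_iff_not_imp_right, SetLike.not_le_iff_exists]
  rintro ⟨w, hw, hwR⟩ Z hZ
  obtain ⟨X, Y, rfl⟩ := mem_localSum.1 (hE hw)
  obtain ⟨i, j, hu⟩ : ∃ i j, tracelessPart X i j ≠ 0 := by
    by_contra! h0
    have h0' : tracelessPart X = 0 := Matrix.ext h0
    rw [tracelessPart_apply, sub_eq_zero] at h0'
    refine hwR (mem_rightLocal.2 ⟨(X.trace / Fintype.card m) • 1 + Y, ?_⟩)
    conv_rhs => rw [h0']
    rw [Matrix.kronecker_add, Matrix.smul_kronecker, Matrix.kronecker_smul]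
  have hmem := hW.left _ (preservesTraceSplitting_entryOp i j hZ) _ hw
  rw [map_add, leftLift_kronecker, leftLift_kronecker, entryOp_apply, entryOp_apply,
    tracelessPart_one, Matrix.zero_apply, zero_smul, Matrix.zero_kronecker, add_zero,
    Matrix.smul_kronecker] at hmem
  exact (W.smul_mem_iff hu).1 hmem

/-- The mirror image of `IsLiftStable.kronecker_one_mem_or_le`. -/
theorem IsLiftStable.one_kronecker_mem_or_le [Nonempty m] [Nonempty n]
    {W : Submodule ℂ (Matrix (m × n) (m × n) ℂ)} (hW : IsLiftStable W) (hE : W ≤ localSum m n) :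
    (∀ Y : Matrix n n ℂ, Y.trace = 0 → (1 : Matrix m m ℂ) ⊗ₖ Y ∈ W) ∨ W ≤ leftLocal m n := by
  rw [or_iff_not_imp_right, SetLike.not_le_iff_exists]
  rintro ⟨w, hw, hwR⟩ Z hZ
  obtain ⟨X, Y, rfl⟩ := mem_localSum.1 (hE hw)
  obtain ⟨i, j, hu⟩ : ∃ i j, tracelessPart Y i j ≠ 0 := by
    by_contra! h0
    have h0' : tracelessPart Y = 0 := Matrix.ext h0
    rw [tracelessPart_apply, sub_eq_zero] at h0'
    refine hwR (mem_leftLocal.2 ⟨X + (Y.trace / Fintype.card n) • 1, ?_⟩)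
    conv_rhs => rw [h0']
    rw [Matrix.add_kronecker, Matrix.smul_kronecker, Matrix.kronecker_smul]
  have hmem := hW.right _ (preservesTraceSplitting_entryOp i j hZ) _ hw
  rw [map_add, rightLift_kronecker, rightLift_kronecker, entryOp_apply, entryOp_apply,
    tracelessPart_one, Matrix.zero_apply, zero_smul, Matrix.kronecker_zero, zero_add,
    Matrix.kronecker_smul] at hmem
  exact (W.smul_mem_iff hu).1 hmem

theorem conj_kronecker_one_mem {V : Matrix (m × n) (m × n) ℂ}
    (hV : V ∈ Matrix.unitaryGroup (m × n) ℂ) {S : Submodule ℂ (Matrix (m × n) (m × n) ℂ)}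
    (h1 : 1 ∈ S) [Nonempty m]
    (h : ∀ X : Matrix m m ℂ, X.trace = 0 → V * (X ⊗ₖ (1 : Matrix n n ℂ)) * Vᴴ ∈ S)
    (X : Matrix m m ℂ) : V * (X ⊗ₖ (1 : Matrix n n ℂ)) * Vᴴ ∈ S := by
  have hV1 : V * Vᴴ = 1 := Matrix.mem_unitaryGroup_iff.1 hV
  have hX : X = tracelessPart X + (X.trace / Fintype.card m) • (1 : Matrix m m ℂ) := by
    rw [tracelessPart_apply, sub_add_cancel]
  rw [hX, Matrix.add_kronecker, Matrix.mul_add, Matrix.add_mul, Matrix.smul_kronecker,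
    Matrix.one_kronecker_one, Matrix.mul_smul, Matrix.smul_mul, Matrix.mul_one, hV1]
  exact S.add_mem (h _ (trace_tracelessPart X)) (S.smul_mem _ h1)

theorem conj_one_kronecker_mem {V : Matrix (m × n) (m × n) ℂ}
    (hV : V ∈ Matrix.unitaryGroup (m × n) ℂ) {S : Submodule ℂ (Matrix (m × n) (m × n) ℂ)}
    (h1 : 1 ∈ S) [Nonempty n]
    (h : ∀ Y : Matrix n n ℂ, Y.trace = 0 → V * ((1 : Matrix m m ℂ) ⊗ₖ Y) * Vᴴ ∈ S)
    (Y : Matrix n n ℂ) : V * ((1 : Matrix m m ℂ) ⊗ₖ Y) * Vᴴ ∈ S := by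
  have hV1 : V * Vᴴ = 1 := Matrix.mem_unitaryGroup_iff.1 hV
  have hY : Y = tracelessPart Y + (Y.trace / Fintype.card n) • (1 : Matrix n n ℂ) := by
    rw [tracelessPart_apply, sub_add_cancel]
  rw [hY, Matrix.kronecker_add, Matrix.mul_add, Matrix.add_mul, Matrix.kronecker_smul,
    Matrix.one_kronecker_one, Matrix.mul_smul, Matrix.smul_mul, Matrix.mul_one, hV1]
  exact S.add_mem (h _ (trace_tracelessPart Y)) (S.smul_mem _ h1)

theorem one_mem_leftLocal : (1 : Matrix (m × n) (m × n) ℂ) ∈ leftLocal m n :=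
  mem_leftLocal.2 ⟨1, Matrix.one_kronecker_one⟩

theorem one_mem_rightLocal : (1 : Matrix (m × n) (m × n) ℂ) ∈ rightLocal m n :=
  mem_rightLocal.2 ⟨1, Matrix.one_kronecker_one⟩

/-- The possible nonzero stable subspaces of traceless local sums are `𝔰𝔩(m) ⊗ 1`, `1 ⊗ 𝔰𝔩(n)` and
their sum; if `V` preserves such a subspace, it preserves one of the two local algebras or maps both
to local sums. -/
theorem IsLiftStable.conj_trichotomy [Nonempty m] [Nonempty n]
    {W : Submodule ℂ (Matrix (m × n) (m × n) ℂ)} (hW : IsLiftStable W) (hE : W ≤ localSum m n)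
    (htr : ∀ M ∈ W, M.trace = 0) (h0 : W ≠ ⊥) {V : Matrix (m × n) (m × n) ℂ}
    (hV : V ∈ Matrix.unitaryGroup (m × n) ℂ) (hVW : ∀ M ∈ W, V * M * Vᴴ ∈ W) :
    (∀ X : Matrix m m ℂ, V * (X ⊗ₖ (1 : Matrix n n ℂ)) * Vᴴ ∈ leftLocal m n) ∨
    (∀ Y : Matrix n n ℂ, V * ((1 : Matrix m m ℂ) ⊗ₖ Y) * Vᴴ ∈ rightLocal m n) ∨
    ((∀ X : Matrix m m ℂ, V * (X ⊗ₖ (1 : Matrix n n ℂ)) * Vᴴ ∈ localSum m n) ∧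
      ∀ Y : Matrix n n ℂ, V * ((1 : Matrix m m ℂ) ⊗ₖ Y) * Vᴴ ∈ localSum m n) := by
  rcases hW.kronecker_one_mem_or_le hE with hL | hL <;>
    rcases hW.one_kronecker_mem_or_le hE with hR | hR
  · have h1 : (1 : Matrix (m × n) (m × n) ℂ) ∈ localSum m n :=
      Submodule.mem_sup_left one_mem_leftLocal
    exact Or.inr (Or.inr ⟨conj_kronecker_one_mem hV h1 fun X hX => hE (hVW _ (hL X hX)),
      conj_one_kronecker_mem hV h1 fun Y hY => hE (hVW _ (hR Y hY))⟩)
  · exact Or.inl (conj_kronecker_one_mem hV one_mem_leftLocal fun X hX => hR (hVW _ (hL X hX)))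
  · exact Or.inr (Or.inl
      (conj_one_kronecker_mem hV one_mem_rightLocal fun Y hY => hL (hVW _ (hR Y hY))))
  · exfalso
    apply h0
    rw [eq_bot_iff]
    intro M hM
    obtain ⟨X, rfl⟩ := mem_leftLocal.1 (hR hM)
    obtain ⟨Y, hY⟩ := mem_rightLocal.1 (hL hM)
    obtain ⟨a⟩ := ‹Nonempty n›
    have hX : X = Y a a • 1 := by
      ext i j
      have := congrFun (congrFun hY (i, a)) (j, a)
      simp only [Matrix.kroneckerMap_apply, Matrix.one_apply_eq, mul_one] at this
      rw [← this, Matrix.smul_apply, smul_eq_mul, mul_comm]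
    have htr' := htr _ hM
    rw [hX, Matrix.smul_kronecker, Matrix.one_kronecker_one, Matrix.trace_smul, Matrix.trace_one,
      smul_eq_mul, mul_eq_zero] at htr'
    have : Nonempty n := ⟨a⟩
    rw [hX, htr'.resolve_right (Nat.cast_ne_zero.2 Fintype.card_ne_zero), zero_smul,
      Matrix.zero_kronecker]
    exact Submodule.zero_mem _

end Lifts

/-! ### The trace form and invariant subspaces -/

section Duality

variable {p : Type} [Fintype p] [DecidableEq p]

/-- The traceless matrices orthogonal to `W` for the trace form. -/
def traceOrthogonal (W : Submodule ℂ (Matrix p p ℂ)) : Submodule ℂ (Matrix p p ℂ) where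
  carrier := {Z | Z.trace = 0 ∧ ∀ M ∈ W, (Z * M).trace = 0}
  zero_mem' := ⟨Matrix.trace_zero _ _, fun M _ => by rw [Matrix.zero_mul, Matrix.trace_zero]⟩
  add_mem' := fun {Y Z} hY hZ => ⟨by rw [Matrix.trace_add, hY.1, hZ.1, add_zero], fun M hM => by
    rw [Matrix.add_mul, Matrix.trace_add, hY.2 M hM, hZ.2 M hM, add_zero]⟩
  smul_mem' := fun c Z hZ => ⟨by rw [Matrix.trace_smul, hZ.1, smul_zero], fun M hM => by
    rw [Matrix.smul_mul, Matrix.trace_smul, hZ.2 M hM, smul_zero]⟩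

theorem mem_traceOrthogonal {W : Submodule ℂ (Matrix p p ℂ)} {Z : Matrix p p ℂ} :
    Z ∈ traceOrthogonal W ↔ Z.trace = 0 ∧ ∀ M ∈ W, (Z * M).trace = 0 := Iff.rfl

theorem traceOrthogonal_ne_bot [Nonempty p] {W : Submodule ℂ (Matrix p p ℂ)}
    (htr : ∀ M ∈ W, M.trace = 0) {X : Matrix p p ℂ} (hX : X.trace = 0) (hXW : X ∉ W) :
    traceOrthogonal W ≠ ⊥ := by
  have hlt : W ⊔ Submodule.span ℂ {(1 : Matrix p p ℂ)} < ⊤ := by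
    refine lt_top_iff_ne_top.2 fun h => hXW ?_
    obtain ⟨w, hw, y, hy, hwy⟩ := Submodule.mem_sup.1 (h.ge (Submodule.mem_top (x := X)))
    obtain ⟨c, rfl⟩ := Submodule.mem_span_singleton.1 hy
    have h1 := congrArg Matrix.trace hwy
    rw [Matrix.trace_add, htr w hw, hX, zero_add, Matrix.trace_smul, Matrix.trace_one, smul_eq_mul,
      mul_eq_zero] at h1
    rw [h1.resolve_right (Nat.cast_ne_zero.2 Fintype.card_ne_zero), zero_smul, add_zero] at hwy
    exact hwy ▸ hw
  obtain ⟨f, hf, hle⟩ := Submodule.exists_le_ker_of_lt_top _ hlt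
  -- Every linear functional on matrices has the form `M ↦ tr (Z M)`.
  let Z : Matrix p p ℂ := Matrix.of fun i j => f (Matrix.single j i 1)
  have hZ : ∀ M, (Z * M).trace = f M := fun M => by
    conv_rhs => rw [Matrix.matrix_eq_sum_single M]
    rw [map_sum, Matrix.trace, Finset.sum_congr rfl fun i _ => by
      rw [Matrix.diag_apply, Matrix.mul_apply], Finset.sum_comm]
    refine Finset.sum_congr rfl fun i _ => ?_
    rw [map_sum]
    refine Finset.sum_congr rfl fun j _ => ?_
    rw [← mul_one (M i j), ← smul_eq_mul (M i j), ← Matrix.smul_single, map_smul, smul_eq_mul,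
      smul_eq_mul, mul_one, mul_comm]
    rfl
  intro h
  apply hf
  have hZ0 : Z ∈ traceOrthogonal W := by
    refine mem_traceOrthogonal.2 ⟨?_, fun M hM => ?_⟩
    · rw [← Matrix.mul_one Z, hZ]
      exact hle (Submodule.mem_sup_right (Submodule.mem_span_singleton_self _))
    · rw [hZ]
      exact hle (Submodule.mem_sup_left hM)
  rw [h, Submodule.mem_bot] at hZ0
  ext1 M
  rw [← hZ, hZ0, Matrix.zero_mul, Matrix.trace_zero, LinearMap.zero_apply]

/-- Stability of `W` under conjugation by a subgroup of `SU(p)`. -/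
def IsConjStable (G : Subgroup (SU p)) (W : Submodule ℂ (Matrix p p ℂ)) : Prop :=
  ∀ g ∈ G, ∀ M ∈ W, (g : Matrix p p ℂ) * M * (g : Matrix p p ℂ)ᴴ ∈ W

theorem IsConjStable.traceOrthogonal {G : Subgroup (SU p)} {W : Submodule ℂ (Matrix p p ℂ)}
    (hW : IsConjStable G W) : IsConjStable G (traceOrthogonal W) := by
  intro g hg Z hZ
  refine mem_traceOrthogonal.2 ⟨(SU.trace_conj g Z).trans hZ.1, fun M hM => ?_⟩
  have h1 := hZ.2 _ (hW g⁻¹ (inv_mem hg) M hM)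
  rw [coe_inv_SU, Matrix.conjTranspose_conjTranspose] at h1
  rw [← h1, Matrix.mul_assoc, Matrix.mul_assoc, Matrix.trace_mul_comm]
  simp only [Matrix.mul_assoc]

/-- The inclusion of the traceless matrices in all matrices, as a linear map. -/
def slIncl (p : Type) [Fintype p] [DecidableEq p] : slC p →ₗ[ℂ] Matrix p p ℂ where
  toFun X := X
  map_add' _ _ := rfl
  map_smul' _ _ := rfl

/-- If the adjoint action of `G` is reducible, there is a proper nonzero space of traceless matrices
that is stable under conjugation by `G`. -/
theorem exists_isConjStable_of_not_adjointIrreducible [Nontrivial p] {G : Subgroup (SU p)}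
    (hG : ¬ AdjointIrreducible G) : ∃ W : Submodule ℂ (Matrix p p ℂ), IsConjStable G W ∧
      (∀ M ∈ W, M.trace = 0) ∧ W ≠ ⊥ ∧ ∃ X : Matrix p p ℂ, X.trace = 0 ∧ X ∉ W := by
  by_contra! hcon
  apply hG
  have : Nontrivial (slC p) := Module.nontrivial_of_finrank_pos (R := ℂ)
    (zero_lt_one.trans one_lt_finrank_slC)
  have hnt : Nontrivial (Subrepresentation ((adRep p).comp G.subtype)) :=
    ⟨⊥, ⊤, fun h => bot_ne_top (congrArg Subrepresentation.toSubmodule h)⟩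
  refine { eq_bot_or_eq_top := fun σ => ?_ }
  have h := hcon (σ.toSubmodule.map (slIncl p)) (by
    rintro g hg _ ⟨X, hX, rfl⟩
    exact ⟨_, σ.apply_mem_toSubmodule ⟨g, hg⟩ hX, rfl⟩) (by
    rintro _ ⟨X, -, rfl⟩
    exact X.2)
  by_cases h0 : σ.toSubmodule.map (slIncl p) = ⊥
  · left
    apply Subrepresentation.toSubmodule_injective
    exact Submodule.map_injective_of_injective (f := slIncl p) Subtype.val_injective
      (h0.trans (Submodule.map_bot _).symm)
  · right
    apply Subrepresentation.toSubmodule_injective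
    refine eq_top_iff.2 fun X _ => ?_
    obtain ⟨Y, hY, hYX⟩ := h h0 X X.2
    exact (Subtype.ext hYX : Y = X) ▸ hY

theorem not_adjointIrreducible_of_isConjStable {G : Subgroup (SU p)}
    {W : Submodule ℂ (Matrix p p ℂ)} (hW : IsConjStable G W) {X Y : Matrix p p ℂ}
    (hX : X.trace = 0) (hXW : X ∈ W) (hX0 : X ≠ 0) (hY : Y.trace = 0) (hYW : Y ∉ W) :
    ¬ AdjointIrreducible G := by
  intro hG
  let σ : Subrepresentation ((adRep p).comp G.subtype) :=
    { toSubmodule := W.comap (slIncl p)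
      apply_mem_toSubmodule := fun g Z hZ => hW g g.2 Z hZ }
  have hσ : σ = ⊥ ∨ σ = ⊤ := hG.eq_bot_or_eq_top σ
  rcases hσ with h | h
  · have h1 : (⟨X, hX⟩ : slC p) ∈ σ.toSubmodule := hXW
    rw [h] at h1
    exact hX0 (congrArg Subtype.val ((Submodule.mem_bot ℂ).1 h1))
  · have h1 : (⟨Y, hY⟩ : slC p) ∈ σ.toSubmodule := by
      rw [h]; exact Submodule.mem_top
    exact hYW h1

end Duality

/-! ### The mixed group -/

section Tensor

variable {m n : Type} [Fintype m] [DecidableEq m] [Fintype n] [DecidableEq n]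

theorem exists_traceless_sq [Nontrivial n] :
    ∃ X : Matrix n n ℂ, X.trace = 0 ∧ (X * X).trace ≠ 0 ∧ ∀ c : ℂ, X ≠ c • 1 := by
  obtain ⟨i, j, hij⟩ := exists_pair_ne n
  refine ⟨Matrix.single i j 1 + Matrix.single j i 1, ?_, ?_, fun c h => ?_⟩
  · rw [Matrix.trace_add, Matrix.trace_single_eq_of_ne i j _ hij,
      Matrix.trace_single_eq_of_ne j i _ hij.symm, add_zero]
  · have h1 : (Matrix.single i j 1 + Matrix.single j i 1) *
        (Matrix.single i j 1 + Matrix.single j i 1) =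
        (Matrix.single i i 1 + Matrix.single j j 1 : Matrix n n ℂ) := by
      simp [Matrix.add_mul, Matrix.mul_add, hij, hij.symm, add_comm]
    rw [h1, Matrix.trace_add, Matrix.trace_single_eq_same, Matrix.trace_single_eq_same]
    norm_num
  · have := congrFun (congrFun h i) j
    simp [hij, hij.symm] at this

theorem isLiftStable_of_isConjStable_mixedGroup [Nontrivial m] [Nontrivial n]
    {G : Subgroup (SU m)} (hG : AdjointIrreducible G) {H : Subgroup (SU n)}
    (hH : AdjointIrreducible H) {V : SU (m × n)} {W : Submodule ℂ (Matrix (m × n) (m × n) ℂ)}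
    (hW : IsConjStable (mixedGroup G H V) W) : IsLiftStable W :=
  isLiftStable_of_adjointIrreducible hG hH
    (fun g hg M hM =>
      hW (tensorHom m n (g, 1)) (Subgroup.subset_closure (Or.inl (Or.inl ⟨g, hg, rfl⟩))) M hM)
    (fun h hh M hM =>
      hW (tensorHom m n (1, h)) (Subgroup.subset_closure (Or.inl (Or.inr ⟨h, hh, rfl⟩))) M hM)

/-- If the mixed group is reducible, a stable subspace or its orthogonal complement avoids the
summand `𝔰𝔩(m) ⊗ 𝔰𝔩(n)`, since the trace form is nonzero on it; hence `V` preserves one of the local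
algebras or maps both to local sums. -/
theorem conj_trichotomy_of_not_adjointIrreducible [Nontrivial m] [Nontrivial n]
    {G : Subgroup (SU m)} (hG : AdjointIrreducible G) {H : Subgroup (SU n)}
    (hH : AdjointIrreducible H) {V : SU (m × n)} (hV : ¬ AdjointIrreducible (mixedGroup G H V)) :
    (∀ X : Matrix m m ℂ, V.1 * (X ⊗ₖ (1 : Matrix n n ℂ)) * V.1ᴴ ∈ leftLocal m n) ∨
    (∀ Y : Matrix n n ℂ, V.1 * ((1 : Matrix m m ℂ) ⊗ₖ Y) * V.1ᴴ ∈ rightLocal m n) ∨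
    ((∀ X : Matrix m m ℂ, V.1 * (X ⊗ₖ (1 : Matrix n n ℂ)) * V.1ᴴ ∈ localSum m n) ∧
      ∀ Y : Matrix n n ℂ, V.1 * ((1 : Matrix m m ℂ) ⊗ₖ Y) * V.1ᴴ ∈ localSum m n) := by
  have hVU := (Matrix.mem_specialUnitaryGroup_iff.1 V.2).1
  have hVmem : V ∈ mixedGroup G H V := Subgroup.subset_closure (Or.inr rfl)
  obtain ⟨W, hW, htr, h0, Z, hZ, hZW⟩ := exists_isConjStable_of_not_adjointIrreducible hV
  have hW' := hW.traceOrthogonal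
  have hL := isLiftStable_of_isConjStable_mixedGroup hG hH hW
  have hL' := isLiftStable_of_isConjStable_mixedGroup hG hH hW'
  rcases hL.le_localSum_or_kronecker_mem with hE | hE
  · exact hL.conj_trichotomy hE htr h0 hVU (hW V hVmem)
  rcases hL'.le_localSum_or_kronecker_mem with hE' | hE'
  · exact hL'.conj_trichotomy hE' (fun M hM => hM.1) (traceOrthogonal_ne_bot htr hZ hZW) hVU
      (hW' V hVmem)
  exfalso
  obtain ⟨X, hX, hXX, -⟩ := exists_traceless_sq (n := m)
  obtain ⟨Y, hY, hYY, -⟩ := exists_traceless_sq (n := n)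
  have h := (hE' X Y hX hY).2 _ (hE X Y hX hY)
  rw [← Matrix.mul_kronecker_mul, Matrix.trace_kronecker] at h
  exact (mul_ne_zero hXX hYY) h

/-- The traceless local sums form a proper subrepresentation if `V` normalizes the product group. -/
theorem not_adjointIrreducible_mixedGroup_of_mem_normalizer [Nontrivial m] [Nontrivial n]
    (G : Subgroup (SU m)) (H : Subgroup (SU n)) {V : SU (m × n)}
    (hV : V ∈ Subgroup.normalizer (productSU m n : Set (SU (m × n)))) :
    ¬ AdjointIrreducible (mixedGroup G H V) := by
  have hle : mixedGroup G H V ≤ Subgroup.normalizer (productSU m n : Set (SU (m × n))) := by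
    refine (Subgroup.closure_le _).2 ?_
    rintro U ((⟨a, -, rfl⟩ | ⟨b, -, rfl⟩) | rfl)
    · exact Subgroup.le_normalizer ⟨_, rfl⟩
    · exact Subgroup.le_normalizer ⟨_, rfl⟩
    · exact hV
  obtain ⟨X, hX, hXX, hXs⟩ := exists_traceless_sq (n := m)
  obtain ⟨Y, hY, -, hYs⟩ := exists_traceless_sq (n := n)
  refine not_adjointIrreducible_of_isConjStable (W := localSum m n)
    (X := X ⊗ₖ (1 : Matrix n n ℂ)) (Y := X ⊗ₖ Y)
    (fun g hg M hM => conj_localSum_of_mem_normalizer (hle hg) hM) ?_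
    (mem_localSum.2 ⟨X, 0, by rw [Matrix.kronecker_zero, add_zero]⟩) ?_ ?_ ?_
  · rw [Matrix.trace_kronecker, hX, zero_mul]
  · intro h
    rw [← Matrix.zero_kronecker (1 : Matrix n n ℂ)] at h
    rw [kronecker_one_injective h, Matrix.zero_mul, Matrix.trace_zero] at hXX
    exact hXX rfl
  · rw [Matrix.trace_kronecker, hX, zero_mul]
  · intro h
    rcases exists_smul_one_of_kronecker_mem_localSum h with ⟨c, hc⟩ | ⟨c, hc⟩
    · exact hXs c hc
    · exact hYs c hc

/-! ### The product group in the unitary group -/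

/-- The subgroup `SU(m) ⊗ SU(n)` inside the full unitary group. -/
abbrev productU (m n : Type) [Fintype m] [DecidableEq m] [Fintype n] [DecidableEq n] :
    Subgroup (Matrix.unitaryGroup (m × n) ℂ) :=
  (productSU m n).map (SU.toU (m × n))

theorem mem_productU {U : Matrix.unitaryGroup (m × n) ℂ} :
    U ∈ productU m n ↔ ∃ (A : SU m) (B : SU n), (A : Matrix m m ℂ) ⊗ₖ (B : Matrix n n ℂ) = U.1 := by
  constructor
  · rintro ⟨_, ⟨⟨A, B⟩, rfl⟩, rfl⟩
    exact ⟨A, B, rfl⟩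
  · rintro ⟨A, B, h⟩
    exact ⟨_, ⟨(A, B), rfl⟩, Subtype.ext h⟩

theorem toU_mem_productU {U : SU (m × n)} :
    SU.toU (m × n) U ∈ productU m n ↔ U ∈ productSU m n := by
  constructor
  · rintro ⟨U', hU', h⟩
    have : U' = U := Subtype.ext (congrArg (fun x : Matrix.unitaryGroup (m × n) ℂ => x.1) h)
    exact this ▸ hU'
  · exact fun h => ⟨U, h, rfl⟩

theorem exists_phase_mul_productU [Nonempty m] [Nonempty n] {A : Matrix m m ℂ}
    (hA : A ∈ Matrix.unitaryGroup m ℂ) {B : Matrix n n ℂ} (hB : B ∈ Matrix.unitaryGroup n ℂ) :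
    ∃ c : ℂ, ‖c‖ = 1 ∧ ∃ W ∈ productU m n, A ⊗ₖ B = c • (W : Matrix (m × n) (m × n) ℂ) := by
  obtain ⟨c, hc, A', rfl⟩ := exists_phase_mem_specialUnitaryGroup hA
  obtain ⟨d, hd, B', rfl⟩ := exists_phase_mem_specialUnitaryGroup hB
  refine ⟨c * d, by rw [norm_mul, hc, hd, one_mul], SU.toU _ (tensorHom m n (A', B')),
    ⟨_, ⟨_, rfl⟩, rfl⟩, ?_⟩
  rw [Matrix.smul_kronecker, Matrix.kronecker_smul, smul_smul]
  rfl

/-- Conjugation by `c W` with a phase `c` is conjugation by `W`. -/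
theorem upToPhase_subset_normalizer {K : Subgroup (Matrix.unitaryGroup (m × n) ℂ)}
    (hK : K ≤ Subgroup.normalizer (productU m n : Set (Matrix.unitaryGroup (m × n) ℂ))) :
    upToPhase K ⊆ Subgroup.normalizer (productSU m n : Set (SU (m × n))) := by
  rintro U ⟨c, hc, W, hW, hUW⟩
  refine Subgroup.mem_normalizer_iff.2 fun h => ?_
  have hcc : c * star c = 1 := by
    rw [Complex.star_def, Complex.mul_conj', hc]; simp
  have hconj : SU.toU (m × n) (U * h * U⁻¹) = W * SU.toU (m × n) h * W⁻¹ := by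
    apply Subtype.ext
    change U.1 * h.1 * U.1ᴴ = W.1 * h.1 * W.1ᴴ
    have hUW' : U.1 = c • W.1 := hUW
    rw [hUW', Matrix.conjTranspose_smul, Matrix.smul_mul, Matrix.smul_mul, Matrix.mul_smul,
      smul_smul, hcc, one_smul]
  rw [← toU_mem_productU, ← toU_mem_productU, hconj]
  exact Subgroup.mem_normalizer_iff.1 (hK hW) _

/-- Between factors of different dimensions, a unitary that maps both local algebras to local sums
is a product. -/
theorem exists_kronecker_of_card_ne [Nonempty m] [Nonempty n]
    (hmn : Fintype.card m ≠ Fintype.card n) {V : Matrix (m × n) (m × n) ℂ}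
    (hV : V ∈ Matrix.unitaryGroup (m × n) ℂ)
    (hL : ∀ X : Matrix m m ℂ, V * (X ⊗ₖ (1 : Matrix n n ℂ)) * Vᴴ ∈ localSum m n)
    (hR : ∀ Y : Matrix n n ℂ, V * ((1 : Matrix m m ℂ) ⊗ₖ Y) * Vᴴ ∈ localSum m n) :
    ∃ A ∈ Matrix.unitaryGroup m ℂ, ∃ B ∈ Matrix.unitaryGroup n ℂ, V = A ⊗ₖ B := by
  rcases conj_leftLocal_dichotomy hV hL with h1 | h1
  · exact exists_kronecker_of_conj_leftLocal hV h1
  rcases conj_rightLocal_dichotomy hV hR with h2 | h2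
  · exact absurd (le_antisymm (card_le_of_conj_leftLocal hV h1) (card_le_of_conj_rightLocal hV h2))
      hmn
  · exact exists_kronecker_of_conj_rightLocal hV h2

end Tensor

/-! ### SWAP -/

section Swap

variable {k : ℕ}

theorem swapU_mul_self : swapU (rfl : k = k) * swapU rfl = 1 := by
  apply Subtype.ext
  change (swapPerm (rfl : k = k)).permMatrix ℂ * (swapPerm rfl).permMatrix ℂ = 1
  rw [← Matrix.permMatrix_mul]
  have : swapPerm (rfl : k = k) * swapPerm rfl = 1 := rfl
  rw [this, Matrix.permMatrix_one]

theorem swapU_conj_kronecker (X Y : Matrix (Fin k) (Fin k) ℂ) :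
    (swapU (rfl : k = k)).1 * (X ⊗ₖ Y) * (swapU (rfl : k = k)).1ᴴ = Y ⊗ₖ X := by
  change (swapPerm (rfl : k = k)).permMatrix ℂ * (X ⊗ₖ Y) * ((swapPerm rfl).permMatrix ℂ)ᴴ = _
  rw [Matrix.conjTranspose_permMatrix, Equiv.Perm.permMatrix, Equiv.Perm.permMatrix,
    PEquiv.toMatrix_toPEquiv_mul, PEquiv.mul_toMatrix_toPEquiv, Matrix.submatrix_submatrix]
  exact submatrix_swap_kronecker X Y

theorem swapU_inv : (swapU (rfl : k = k))⁻¹ = swapU rfl :=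
  inv_eq_of_mul_eq_one_right swapU_mul_self

theorem swapU_conj_mem_productU {U : Matrix.unitaryGroup (Fin k × Fin k) ℂ}
    (hU : U ∈ productU (Fin k) (Fin k)) :
    swapU rfl * U * (swapU rfl)⁻¹ ∈ productU (Fin k) (Fin k) := by
  obtain ⟨A, B, hAB⟩ := mem_productU.1 hU
  refine mem_productU.2 ⟨B, A, ?_⟩
  change _ = (swapU (rfl : k = k)).1 * U.1 * (swapU (rfl : k = k)).1ᴴ
  rw [← hAB, swapU_conj_kronecker]

theorem productU_sup_zpowers_swapU_le_normalizer :
    productU (Fin k) (Fin k) ⊔ Subgroup.zpowers (swapU rfl) ≤ Subgroup.normalizer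
      (productU (Fin k) (Fin k) : Set (Matrix.unitaryGroup (Fin k × Fin k) ℂ)) := by
  refine sup_le Subgroup.le_normalizer (Subgroup.zpowers_le.2 ?_)
  refine Subgroup.mem_normalizer_iff.2 fun U => ⟨swapU_conj_mem_productU, fun h => ?_⟩
  have h2 := swapU_conj_mem_productU h
  rwa [swapU_inv, mul_assoc, mul_assoc, mul_assoc, swapU_mul_self, mul_one, ← mul_assoc,
    swapU_mul_self, one_mul] at h2

/-- Between factors of the same dimension, a unitary that maps the first local algebra to local
sums is a product, up to composition with SWAP. -/
theorem exists_kronecker_or_swap [NeZero k] {V : Matrix (Fin k × Fin k) (Fin k × Fin k) ℂ}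
    (hV : V ∈ Matrix.unitaryGroup (Fin k × Fin k) ℂ)
    (hL : ∀ X : Matrix (Fin k) (Fin k) ℂ,
      V * (X ⊗ₖ (1 : Matrix (Fin k) (Fin k) ℂ)) * Vᴴ ∈ localSum (Fin k) (Fin k)) :
    ∃ A ∈ Matrix.unitaryGroup (Fin k) ℂ, ∃ B ∈ Matrix.unitaryGroup (Fin k) ℂ,
      V = A ⊗ₖ B ∨ V = (swapU (rfl : k = k)).1 * (A ⊗ₖ B) := by
  rcases conj_leftLocal_dichotomy hV hL with h1 | h1
  · obtain ⟨A, hA, B, hB, h⟩ := exists_kronecker_of_conj_leftLocal hV h1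
    exact ⟨A, hA, B, hB, Or.inl h⟩
  have hSV := mul_mem (swapU (rfl : k = k)).2 hV
  obtain ⟨A, hA, B, hB, h⟩ := exists_kronecker_of_conj_leftLocal hSV fun X => by
    obtain ⟨Y, hY⟩ := mem_rightLocal.1 (h1 X)
    refine mem_leftLocal.2 ⟨Y, ?_⟩
    rw [← swapU_conj_kronecker, hY, Matrix.conjTranspose_mul]
    simp only [Matrix.mul_assoc]
  refine ⟨A, hA, B, hB, Or.inr ?_⟩
  have hSS : (swapU (rfl : k = k)).1 * (swapU (rfl : k = k)).1 = 1 :=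
    congrArg Subtype.val swapU_mul_self
  rw [← h, ← Matrix.mul_assoc, hSS, Matrix.one_mul]

end Swap

/-! ### The normalizer and the criterion for irreducibility -/

section Normalizer

theorem mem_upToPhase_of_kronecker {m n : Type} [Fintype m] [DecidableEq m] [Fintype n]
    [DecidableEq n] [Nonempty m] [Nonempty n] {V : SU (m × n)}
    (h : ∃ A ∈ Matrix.unitaryGroup m ℂ, ∃ B ∈ Matrix.unitaryGroup n ℂ, V.1 = A ⊗ₖ B) :
    V ∈ upToPhase (productU m n) := by
  obtain ⟨A, hA, B, hB, hAB⟩ := h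
  obtain ⟨c, hc, W, hW, h⟩ := exists_phase_mul_productU hA hB
  exact ⟨c, hc, W, hW, hAB.trans h⟩

theorem mem_upToPhase_of_kronecker_or_swap {k : ℕ} [NeZero k] {V : SU (Fin k × Fin k)}
    (h : ∃ A ∈ Matrix.unitaryGroup (Fin k) ℂ, ∃ B ∈ Matrix.unitaryGroup (Fin k) ℂ,
      V.1 = A ⊗ₖ B ∨ V.1 = (swapU (rfl : k = k)).1 * (A ⊗ₖ B)) :
    V ∈ upToPhase (productU (Fin k) (Fin k) ⊔ Subgroup.zpowers (swapU rfl)) := by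
  obtain ⟨A, hA, B, hB, hAB⟩ := h
  obtain ⟨c, hc, W, hW, h⟩ := exists_phase_mul_productU hA hB
  rcases hAB with hAB | hAB
  · exact ⟨c, hc, W, Subgroup.mem_sup_left hW, hAB.trans h⟩
  · refine ⟨c, hc, swapU rfl * W, mul_mem (Subgroup.mem_sup_right (Subgroup.mem_zpowers _))
      (Subgroup.mem_sup_left hW), ?_⟩
    change V.1 = c • ((swapU (rfl : k = k)).1 * W.1)
    rw [hAB, h, Matrix.mul_smul]

end Normalizer

theorem mainTheorem7 (k l : ℕ) (hk : 2 ≤ k) (hl : 2 ≤ l)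
    (Gk : Subgroup (SU (Fin k))) (Gl : Subgroup (SU (Fin l)))
    (hGk : AdjointIrreducible Gk) (hGl : AdjointIrreducible Gl)
    (V : SU (Fin k × Fin l)) :
    (AdjointIrreducible (mixedGroup Gk Gl V) ↔
      V ∉ Subgroup.normalizer (productSU (Fin k) (Fin l) : Set (SU (Fin k × Fin l)))) ∧
    (k ≠ l →
      (Subgroup.normalizer (productSU (Fin k) (Fin l) : Set (SU (Fin k × Fin l))) :
          Set (SU (Fin k × Fin l))) =
        upToPhase ((productSU (Fin k) (Fin l)).map (SU.toU (Fin k × Fin l)))) ∧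
    (∀ h : k = l,
      (Subgroup.normalizer (productSU (Fin k) (Fin l) : Set (SU (Fin k × Fin l))) :
          Set (SU (Fin k × Fin l))) =
        upToPhase ((productSU (Fin k) (Fin l)).map (SU.toU (Fin k × Fin l)) ⊔
          Subgroup.zpowers (swapU h))) := by
  have : Nontrivial (Fin k) := Fin.nontrivial_iff_two_le.2 hk
  have : Nontrivial (Fin l) := Fin.nontrivial_iff_two_le.2 hl
  have : NeZero k := ⟨by omega⟩
  have hU : ∀ U : SU (Fin k × Fin l), U.1 ∈ Matrix.unitaryGroup (Fin k × Fin l) ℂ :=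
    fun U => (Matrix.mem_specialUnitaryGroup_iff.1 U.2).1
  have hcard : k ≠ l → Fintype.card (Fin k) ≠ Fintype.card (Fin l) := fun h => by simpa using h
  refine ⟨⟨fun hirr hV => not_adjointIrreducible_mixedGroup_of_mem_normalizer Gk Gl hV hirr,
    fun hV => ?_⟩, fun hkl => ?_, ?_⟩
  · by_contra hirr
    apply hV
    rcases conj_trichotomy_of_not_adjointIrreducible hGk hGl hirr with h | h | ⟨hL, hR⟩
    · exact upToPhase_subset_normalizer Subgroup.le_normalizer
        (mem_upToPhase_of_kronecker (exists_kronecker_of_conj_leftLocal (hU V) h))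
    · exact upToPhase_subset_normalizer Subgroup.le_normalizer
        (mem_upToPhase_of_kronecker (exists_kronecker_of_conj_rightLocal (hU V) h))
    · by_cases hkl : k = l
      · subst hkl
        exact upToPhase_subset_normalizer productU_sup_zpowers_swapU_le_normalizer
          (mem_upToPhase_of_kronecker_or_swap (exists_kronecker_or_swap (hU V) hL))
      · exact upToPhase_subset_normalizer Subgroup.le_normalizer
          (mem_upToPhase_of_kronecker (exists_kronecker_of_card_ne (hcard hkl) (hU V) hL hR))
  · refine Set.Subset.antisymm (fun U hN => ?_) (upToPhase_subset_normalizer Subgroup.le_normalizer)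
    exact mem_upToPhase_of_kronecker (exists_kronecker_of_card_ne (hcard hkl) (hU U)
      (conj_leftLocal_of_mem_normalizer hN) (conj_rightLocal_of_mem_normalizer hN))
  · rintro rfl
    refine Set.Subset.antisymm (fun U hN => ?_)
      (upToPhase_subset_normalizer productU_sup_zpowers_swapU_le_normalizer)
    exact mem_upToPhase_of_kronecker_or_swap
      (exists_kronecker_or_swap (hU U) (conj_leftLocal_of_mem_normalizer hN))
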